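/- All bodies lie in the plane $\mathbb{R}^2$ with the Euclidean norm, and all masses are positive. For masses $m_1,\dots,m_n$, a *normalized central configuration* (normalized CC) is a tuple $(q_1,\dots,q_n)$ of pairwise distinct points with center of mass $0$ such that $$F_i(q):=q_i-\sum_{j\neq i}\frac{m_j}{|q_i-q_j|^3}(q_i-q_j)=0,\qquad i=1,\dots,n;$$ it is *non-degenerate* if $\operatorname{rank} DF(q)=2n-1$. For $Q=(q_1,\dots,q_N)$ with masses $m=(m_1,\dots,m_N)$ and $p\in\mathbb{R}^2\setminus\{q_1,\dots,q_N\}$ let $$V_{\rm res}(Q,p)=\frac{|p|^2}{2}+\sum_{i=1}^N\frac{m_i}{|p-q_i|}.$$ A *restricted relative equilibrium* for $Q$ is a point $x\notin\{q_1,\dots,q_N\}$ with $\frac{\partial V_{\rm res}}{\partial p}(Q,x)=0$; it is *non-degenerate* if $\frac{\partial^2V_{\rm res}}{\partial p^2}(Q,x)$ is an isomorphism. For $x\notin\{q_1,\dots,q_N\}$ and $\mu=(\mu_1,\dots,\mu_k)$, the *anisotropic potential induced by $(Q,x)$* is $$\widetilde W(p_1,\dots,p_k)=\sum_{j=1}^k\frac{\mu_j}{2}\,\frac{\partial^2V_{\rm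 res}}{\partial p^2}(Q,x)(p_j,p_j)+\sum_{1\le i<j\le k}\frac{\mu_i\mu_j}{|p_i-p_j|}$$ on tuples of pairwise distinct points. A *CC of $\widetilde W$* is a critical point of $\widetilde W$; it is *non-degenerate* if the Hessian of $\widetilde W$ there is an isomorphism. **Theorem.** Let $\hat Q_N=(\hat q_1,\dots,\hat q_N)$ be a non-degenerate normalized CC with masses $m_1,\dots,m_N>0$. Let $x^*$ be a non-degenerate restricted relative equilibrium for $\hat Q_N$. Let $\widetilde\mu_1,\dots,\widetilde\mu_k>0$ with $\sum_j\widetilde\mu_j=1$, and let $\hat P_k=(\hat p_1,\dots,\hat p_k)$ be a non-degenerate CC of the anisotropic potential $\widetilde W$ induced by $(\hat Q_N,x^*)$ with masses $\widetilde\mu$. Then there are $\Theta_0>0$ and $C$ such that for every $\Theta\in(0,\Theta_0)$ there exists a non-degenerate normalized CC $(q_1,\dots,q_N,p_1,\dots,p_k)$ of $N+k$ bodies with masses $m_1,\dots,m_N,\Theta\widetilde\mu_1,\dots,\Theta\widetilde\mu_k$ satisfying $$|q_i-\hat q_i|\le C\,\Theta\quad(1\le i\le N),\qquad \bigl|p_j-x^*-\Theta^{1/3}\hat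 p_j\bigr|\le C\,\Theta^{2/3}\quad(1\le j\le k),$$ that is, $q_i=\hat q_i+\mathcal O(\Theta)$ and $p_j=x^*+\Theta^{1/3}\hat p_j+\mathcal O(\Theta^{2/3})$ as $\Theta\to0^+$. -/

import Mathlib

noncomputable section

namespace CentralConfig

/-- The plane `ℝ²` with its Euclidean norm. -/
abbrev Plane : Type := EuclideanSpace ℝ (Fin 2)

section Newton

variable {ι : Type*} [Fintype ι] [DecidableEq ι]

/-- The center of mass of bodies with masses `m` at positions `q`. -/
def centerOfMass (m : ι → ℝ) (q : ι → Plane) : Plane :=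
  (∑ i, m i)⁻¹ • ∑ i, m i • q i

/-- `q` is a central configuration for the masses `m` with scaling factor `lam`: the bodies do not
collide, and `lam mᵢ (qᵢ - c) = ∑_{j ≠ i} mᵢ mⱼ (qᵢ - qⱼ) / rᵢⱼ³` for every `i`, with `c` the
center of mass. -/
def IsCentralConfiguration (lam : ℝ) (m : ι → ℝ) (q : ι → Plane) : Prop :=
  Function.Injective q ∧ 0 < lam ∧
    ∀ i, (lam * m i) • (q i - centerOfMass m q) =
      ∑ j ∈ Finset.univ.erase i, (m i * m j / ‖q i - q j‖ ^ 3) • (q i - q j)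

/-- Normalized central configuration: `lam = 1` and the center of mass is the origin. -/
def IsNormalizedCC (m : ι → ℝ) (q : ι → Plane) : Prop :=
  IsCentralConfiguration 1 m q ∧ centerOfMass m q = 0

/-- The map `F` with `Fᵢ(q) = qᵢ - ∑_{j ≠ i} mⱼ (qᵢ - qⱼ) / rᵢⱼ³`. -/
def ccMap (m : ι → ℝ) (q : ι → Plane) : ι → Plane := fun i =>
  q i - ∑ j ∈ Finset.univ.erase i, (m j / ‖q i - q j‖ ^ 3) • (q i - q j)

/-- Non-degenerate normalized central configuration in the plane: the rank of `DF(q)` is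
`2 n - dim SO(2) = 2 n - 1` (written without subtraction), `n` being the number of bodies. -/
def IsNondegenerateNormalizedCC (m : ι → ℝ) (q : ι → Plane) : Prop :=
  IsNormalizedCC m q ∧
    Module.finrank ℝ (LinearMap.range (fderiv ℝ (ccMap m) q).toLinearMap) + 1 =
      2 * Fintype.card ι

/-- The potential `V_res(Q, p) = |p|² / 2 + ∑ᵢ mᵢ / |p - qᵢ|` of the restricted problem. -/
def restrictedPotential (m : ι → ℝ) (q : ι → Plane) (p : Plane) : ℝ :=
  ‖p‖ ^ 2 / 2 + ∑ i, m i / ‖p - q i‖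

/-- `x` is a relative normalized central configuration (relative equilibrium) of the restricted
problem for the configuration `q`: a critical point of the potential, away from its poles. -/
def IsRestrictedRelEquilibrium (m : ι → ℝ) (q : ι → Plane) (x : Plane) : Prop :=
  (∀ i, x ≠ q i) ∧ fderiv ℝ (restrictedPotential m q) x = 0

/-- The second derivative `∂²V_res / ∂p²` at `x`, a bilinear form on the plane. -/
def restrictedHessian (m : ι → ℝ) (q : ι → Plane) (x : Plane) : Plane →L[ℝ] Plane →L[ℝ] ℝ :=
  fderiv ℝ (fderiv ℝ (restrictedPotential m q)) x

/-- A relative equilibrium of the restricted problem whose Hessian is an isomorphism. -/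
def IsNondegenerateRestrictedRelEquilibrium (m : ι → ℝ) (q : ι → Plane) (x : Plane) : Prop :=
  IsRestrictedRelEquilibrium m q x ∧ Function.Bijective (restrictedHessian m q x)

end Newton

section Induced

variable {N k : ℕ}

/-- The induced anisotropic potential
`∑ⱼ (μⱼ / 2) ∂²V_res/∂p²(Q, x)(pⱼ, pⱼ) + ∑_{i < j} μᵢ μⱼ / |pᵢ - pⱼ|`. -/
def inducedPotential (m : Fin N → ℝ) (q : Fin N → Plane) (x : Plane) (μ : Fin k → ℝ)
    (p : Fin k → Plane) : ℝ :=
  ∑ j, μ j / 2 * restrictedHessian m q x (p j) (p j) +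
    ∑ i, ∑ j ∈ Finset.Ioi i, μ i * μ j / ‖p i - p j‖

/-- `p` is a central configuration of the potential induced by `(q, x)` for the masses `μ`:
a collision-free critical point of it. -/
def IsInducedCC (m : Fin N → ℝ) (q : Fin N → Plane) (x : Plane) (μ : Fin k → ℝ)
    (p : Fin k → Plane) : Prop :=
  Function.Injective p ∧ fderiv ℝ (inducedPotential m q x μ) p = 0

/-- A central configuration of the induced potential at which the Hessian of that potential
is an isomorphism. -/
def IsNondegenerateInducedCC (m : Fin N → ℝ) (q : Fin N → Plane) (x : Plane) (μ : Fin k → ℝ)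
    (p : Fin k → Plane) : Prop :=
  IsInducedCC m q x μ p ∧
    Function.Bijective (fderiv ℝ (fderiv ℝ (inducedPotential m q x μ)) p)

end Induced

end CentralConfig

end

/-! Put `θ = Θ^(1/3)` and look for the bodies at `q = q₀ + θ³ v`, `p = x + θ w`. The light bodies
have total mass of order `θ³`, so they shift the heavy ones by `O(θ³)`. Inside the cluster, masses
of order `θ³` at distances of order `θ` attract with strength `θ³ / θ² = θ`, the same order as the
linearized restricted field. Dividing the heavy equations by `θ³` and the light ones by `θ`
therefore gives a finite limit, which decouples: an affine equation `DF(q₀) v = const`, and the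
critical point equation of the anisotropic potential for `w`.

Rotations make `DF(q₀)` singular. A rank one term `l(q - q₀) e`, with `e` the rotation field at
`q₀`, restores invertibility (`exists_injective_add_smulRight`). It costs nothing: `F` has zero
total torque (`torque_ccMap`) while `e` does not, so at a zero of the corrected map the correction
vanishes (`ccMap_eq_zero_of_augmentedMap`).

The corrected limit has an invertible derivative at its zero. The rescaled map differs from it by an
error that is `O(θ)` in Lipschitz norm on balls (`isSmallFamily_scaledMap`), so a zero persists at
distance `O(θ)` with injective derivative (`exists_zero_of_isSmallFamily`). Injectivity of the
corrected derivative gives back rank `2n - 1`. -/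

noncomputable section

namespace CentralConfig

section Families

open Filter Topology

/-! ### Perturbation of a nondegenerate zero by an error small in Lipschitz norm. -/

section SmallFamily

variable {Y Z W : Type*} [NormedAddCommGroup Y] [NormedAddCommGroup Z] [NormedAddCommGroup W]

/-- A family of maps `E θ`, `θ > 0`, is small if on every ball it is bounded by a multiple of `θ`
and Lipschitz with constant a multiple of `θ`, as `θ → 0⁺`. -/
def IsSmallFamily (E : ℝ → Y → Z) : Prop :=
  ∀ R : ℝ, ∃ C : ℝ, ∀ᶠ θ in 𝓝[>] (0 : ℝ), ∀ y, ‖y‖ ≤ R →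
    ‖E θ y‖ ≤ C * θ ∧ ∀ y', ‖y'‖ ≤ R → ‖E θ y - E θ y'‖ ≤ C * θ * ‖y - y'‖

theorem eventually_pos_nhdsGT : ∀ᶠ θ in 𝓝[>] (0 : ℝ), 0 < θ :=
  eventually_mem_nhdsWithin

theorem IsSmallFamily.congr {E E' : ℝ → Y → Z} (h : IsSmallFamily E)
    (hE : ∀ θ, 0 < θ → E' θ = E θ) : IsSmallFamily E' := by
  intro R
  obtain ⟨C, hC⟩ := h R
  refine ⟨C, ?_⟩
  filter_upwards [hC, eventually_pos_nhdsGT] with θ h1 h2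
  rw [hE θ h2]
  exact h1

theorem IsSmallFamily.add {E E' : ℝ → Y → Z} (h : IsSmallFamily E) (h' : IsSmallFamily E') :
    IsSmallFamily (fun θ y => E θ y + E' θ y) := by
  intro R
  obtain ⟨C, hC⟩ := h R
  obtain ⟨C', hC'⟩ := h' R
  refine ⟨C + C', ?_⟩
  filter_upwards [hC, hC'] with θ h1 h2 y hy
  refine ⟨(norm_add_le _ _).trans ?_, fun y' hy' => ?_⟩
  · linarith [(h1 y hy).1, (h2 y hy).1]
  · rw [add_sub_add_comm]
    refine (norm_add_le _ _).trans ?_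
    linarith [(h1 y hy).2 y' hy', (h2 y hy).2 y' hy']

theorem isSmallFamily_zero : IsSmallFamily (fun (_ : ℝ) (_ : Y) => (0 : Z)) := by
  intro R
  exact ⟨0, Eventually.of_forall fun θ y _ => by simp⟩

theorem isSmallFamily_sum {ι : Type*} (s : Finset ι) {E : ι → ℝ → Y → Z}
    (h : ∀ i ∈ s, IsSmallFamily (E i)) : IsSmallFamily (fun θ y => ∑ i ∈ s, E i θ y) := by
  classical
  induction s using Finset.induction_on with
  | empty => simpa using isSmallFamily_zero
  | insert a s ha ih =>
    simp only [Finset.sum_insert ha]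
    exact (h a (by simp)).add (ih fun i hi => h i (by simp [hi]))

theorem IsSmallFamily.clm_comp [NormedSpace ℝ Z] [NormedSpace ℝ W] {E : ℝ → Y → Z} (h : IsSmallFamily E) (L : Z →L[ℝ] W) :
    IsSmallFamily (fun θ y => L (E θ y)) := by
  intro R
  obtain ⟨C, hC⟩ := h R
  refine ⟨‖L‖ * C, ?_⟩
  filter_upwards [hC] with θ h1 y hy
  refine ⟨(L.le_opNorm _).trans ?_, fun y' hy' => ?_⟩
  · rw [mul_assoc]
    exact mul_le_mul_of_nonneg_left (h1 y hy).1 (norm_nonneg _)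
  · rw [← map_sub, mul_assoc, mul_assoc, ← mul_assoc C]
    exact (L.le_opNorm _).trans
      (mul_le_mul_of_nonneg_left ((h1 y hy).2 y' hy') (norm_nonneg _))

/-- Lets the blown up variables enter through combinations such as `θ² v - w`. Near `θ = 0` the
norms `‖B θ‖` are bounded, so balls go into a fixed larger ball. -/
theorem IsSmallFamily.comp_clm [NormedSpace ℝ Y] [NormedSpace ℝ W] {E : ℝ → W → Z} (h : IsSmallFamily E) {B : ℝ → Y →L[ℝ] W}
    (hB : Continuous B) : IsSmallFamily (fun θ y => E θ (B θ y)) := by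
  intro R
  set M : ℝ := ‖B 0‖ + 1 with hM
  have hMpos : 0 < M := by positivity
  have hBM : ∀ᶠ θ in 𝓝[>] (0 : ℝ), ‖B θ‖ < M :=
    ((hB.norm.tendsto 0).mono_left nhdsWithin_le_nhds).eventually_lt_const (by simp [hM])
  obtain ⟨C, hC⟩ := h (M * |R|)
  refine ⟨|C| * (M + 1), ?_⟩
  filter_upwards [hC, hBM, eventually_pos_nhdsGT] with θ h1 h2 h3 y hy
  have hb : ∀ z : Y, ‖B θ z‖ ≤ M * ‖z‖ := fun z =>
    ((B θ).le_opNorm z).trans (by gcongr)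
  have hb' : ∀ z : Y, ‖z‖ ≤ R → ‖B θ z‖ ≤ M * |R| := fun z hz =>
    (hb z).trans (by gcongr; exact hz.trans (le_abs_self R))
  refine ⟨((h1 _ (hb' y hy)).1).trans ?_, fun y' hy' => ?_⟩
  · have h4 : C ≤ |C| := le_abs_self C
    have h5 : 0 ≤ |C| * M := by positivity
    exact mul_le_mul_of_nonneg_right (by linarith) h3.le
  · refine ((h1 _ (hb' y hy)).2 _ (hb' y' hy')).trans ?_
    rw [← map_sub]
    calc C * θ * ‖B θ (y - y')‖ ≤ |C| * θ * (M * ‖y - y'‖) := by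
          gcongr
          · exact le_abs_self C
          · exact hb _
      _ ≤ |C| * (M + 1) * θ * ‖y - y'‖ := by
          have : 0 ≤ |C| * θ * ‖y - y'‖ := by positivity
          linarith

theorem IsSmallFamily.comp_pow {E : ℝ → Y → Z} (h : IsSmallFamily E) {n : ℕ} (hn : n ≠ 0) :
    IsSmallFamily (fun θ y => E (θ ^ n) y) := by
  intro R
  obtain ⟨C, hC⟩ := h R
  refine ⟨|C|, ?_⟩
  have ht : Tendsto (fun θ : ℝ => θ ^ n) (𝓝[>] 0) (𝓝[>] 0) := by
    refine tendsto_nhdsWithin_iff.2 ⟨?_, ?_⟩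
    · have : Tendsto (fun θ : ℝ => θ ^ n) (𝓝 0) (𝓝 (0 ^ n)) := (continuous_pow n).tendsto 0
      rw [zero_pow hn] at this
      exact this.mono_left nhdsWithin_le_nhds
    · filter_upwards [eventually_pos_nhdsGT] with θ hθ using pow_pos hθ n
  have h1 : ∀ᶠ θ in 𝓝[>] (0 : ℝ), θ < 1 :=
    eventually_nhdsWithin_of_eventually_nhds (eventually_lt_nhds one_pos)
  filter_upwards [ht.eventually hC, eventually_pos_nhdsGT, h1] with θ h2 h3 h4 y hy
  have h5 : C * θ ^ n ≤ |C| * θ := by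
    have : θ ^ n ≤ θ := pow_le_of_le_one h3.le h4.le hn
    calc C * θ ^ n ≤ |C| * θ ^ n := by gcongr; exact le_abs_self C
      _ ≤ |C| * θ := by gcongr
  exact ⟨(h2 y hy).1.trans h5, fun y' hy' => ((h2 y hy).2 y' hy').trans (by gcongr)⟩

theorem isSmallFamily_pi {ι : Type*} [Fintype ι] {Z : ι → Type*} [∀ i, NormedAddCommGroup (Z i)]
    {E : ℝ → Y → ∀ i, Z i} (h : ∀ i, IsSmallFamily (fun θ y => E θ y i)) :
    IsSmallFamily E := by
  intro R
  choose C hC using fun i => h i R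
  refine ⟨∑ i, |C i|, ?_⟩
  filter_upwards [eventually_all.2 hC, eventually_pos_nhdsGT] with θ h1 h2 y hy
  have hle : ∀ i, C i ≤ ∑ i, |C i| := fun i =>
    (le_abs_self _).trans
      (Finset.single_le_sum (f := fun i => |C i|) (fun _ _ => abs_nonneg _) (Finset.mem_univ i))
  refine ⟨(pi_norm_le_iff_of_nonneg (by positivity)).2 fun i => ((h1 i y hy).1).trans ?_,
    fun y' hy' => (pi_norm_le_iff_of_nonneg (by positivity)).2 fun i =>
      ((h1 i y hy).2 y' hy').trans ?_⟩
  · exact mul_le_mul_of_nonneg_right (hle i) h2.le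
  · exact mul_le_mul_of_nonneg_right (mul_le_mul_of_nonneg_right (hle i) h2.le) (norm_nonneg _)

theorem IsSmallFamily.prodMk [NormedSpace ℝ Z] [NormedSpace ℝ W] {E : ℝ → Y → Z} {E' : ℝ → Y → W} (h : IsSmallFamily E)
    (h' : IsSmallFamily E') : IsSmallFamily (fun θ y => (E θ y, E' θ y)) := by
  refine ((h.clm_comp (ContinuousLinearMap.inl ℝ Z W)).add
    (h'.clm_comp (ContinuousLinearMap.inr ℝ Z W))).congr fun θ _ => ?_
  ext y <;> simp

theorem isSmallFamily_smul_clm [NormedSpace ℝ Y] [NormedSpace ℝ Z]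
    (L : Y →L[ℝ] Z) :
    IsSmallFamily (fun θ y => θ • L y) := by
  intro R
  refine ⟨‖L‖ * (|R| + 1), ?_⟩
  filter_upwards [eventually_pos_nhdsGT] with θ hθ y hy
  have hb : ∀ y, ‖θ • L y‖ ≤ ‖L‖ * θ * ‖y‖ := fun y => by
    rw [norm_smul, Real.norm_of_nonneg hθ.le]
    calc θ * ‖L y‖ ≤ θ * (‖L‖ * ‖y‖) := by gcongr; exact L.le_opNorm y
      _ = ‖L‖ * θ * ‖y‖ := by ring
  refine ⟨(hb y).trans ?_, fun y' _ => ?_⟩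
  · have : ‖y‖ ≤ |R| + 1 := by linarith [le_abs_self R]
    calc ‖L‖ * θ * ‖y‖ ≤ ‖L‖ * θ * (|R| + 1) := by gcongr
      _ = _ := by ring
  · rw [← smul_sub, ← map_sub]
    refine (hb _).trans ?_
    gcongr
    nlinarith [norm_nonneg L, abs_nonneg R]

theorem isSmallFamily_of_contDiffAt_one [NormedSpace ℝ Y] [NormedSpace ℝ Z]
    {f : Y → Z} {a : Y} (hf : ContDiffAt ℝ 1 f a) :
    IsSmallFamily (fun θ w => f (a + θ • w) - f a) := by
  obtain ⟨K, t, ht, hK⟩ := hf.exists_lipschitzOnWith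
  obtain ⟨δ, hδ, hball⟩ := Metric.mem_nhds_iff.1 ht
  intro R
  refine ⟨K * (|R| + 1), ?_⟩
  have h1 : ∀ᶠ θ in 𝓝[>] (0 : ℝ), θ * (|R| + 1) < δ := by
    have : Tendsto (fun θ : ℝ => θ * (|R| + 1)) (𝓝 0) (𝓝 (0 * (|R| + 1))) :=
      (continuous_id.mul continuous_const).tendsto 0
    rw [zero_mul] at this
    exact (this.mono_left nhdsWithin_le_nhds).eventually_lt_const hδ
  filter_upwards [h1, eventually_pos_nhdsGT] with θ h2 hθ y hy
  have hR : R ≤ |R| + 1 := by linarith [le_abs_self R]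
  have hmem : ∀ w : Y, ‖w‖ ≤ R → a + θ • w ∈ t := fun w hw => hball (by
    rw [mem_ball_iff_norm, add_sub_cancel_left, norm_smul, Real.norm_of_nonneg hθ.le]
    exact (mul_le_mul_of_nonneg_left (hw.trans hR) hθ.le).trans_lt h2)
  have ha : a ∈ t := mem_of_mem_nhds ht
  have key : ∀ w w' : Y, a + θ • w ∈ t → a + θ • w' ∈ t →
      ‖f (a + θ • w) - f (a + θ • w')‖ ≤ K * (θ * ‖w - w'‖) := fun w w' hw hw' => by
    refine (hK.norm_sub_le hw hw').trans (le_of_eq ?_)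
    rw [add_sub_add_left_eq_sub, ← smul_sub, norm_smul, Real.norm_of_nonneg hθ.le]
  refine ⟨?_, fun y' hy' => ?_⟩
  · have := key y 0 (hmem y hy) (by simpa using ha)
    simp only [smul_zero, add_zero, sub_zero] at this
    refine this.trans ?_
    rw [mul_comm θ, ← mul_assoc]
    gcongr
    exact hy.trans hR
  · rw [sub_sub_sub_cancel_right]
    refine (key y y' (hmem y hy) (hmem y' hy')).trans ?_
    rw [← mul_assoc]
    gcongr
    have := abs_nonneg R
    have := K.coe_nonneg
    nlinarith

/-- Zooming in on a zero of a `C²` map leaves its linear part. On the ball of radius `s R'` the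
derivative is within `K s R'` of its value at the centre; the mean value inequality turns this into
a Lipschitz bound, and the factor `s⁻¹` cancels against displacements `s (w - w')`. -/
theorem isSmallFamily_inv_smul_sub_fderiv [NormedSpace ℝ Y] [NormedSpace ℝ Z]
    {f : Y → Z} {a : Y} (hf : ContDiffAt ℝ 2 f a)
    (h0 : f a = 0) : IsSmallFamily (fun s w => s⁻¹ • f (a + s • w) - fderiv ℝ f a w) := by
  obtain ⟨K, t, ht, hK⟩ := (hf.fderiv_right (m := 1) (by norm_num)).exists_lipschitzOnWith
  have hd : ∀ᶠ x in 𝓝 a, DifferentiableAt ℝ f x := by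
    filter_upwards [hf.eventually (by simp)] with x hx
    exact hx.differentiableAt (by norm_num)
  obtain ⟨δ, hδ, hball⟩ := Metric.mem_nhds_iff.1 (inter_mem ht hd)
  intro R
  set R' : ℝ := |R| + 1 with hR'
  have hR'pos : 0 < R' := by positivity
  have hRR : R ≤ R' := by linarith [le_abs_self R]
  refine ⟨K * R' * (R' + 1), ?_⟩
  have h1 : ∀ᶠ θ in 𝓝[>] (0 : ℝ), θ * R' < δ := by
    have : Tendsto (fun θ : ℝ => θ * R') (𝓝 0) (𝓝 (0 * R')) :=
      (continuous_id.mul continuous_const).tendsto 0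
    rw [zero_mul] at this
    exact (this.mono_left nhdsWithin_le_nhds).eventually_lt_const hδ
  filter_upwards [h1, eventually_pos_nhdsGT] with s h2 hs
  have hsub : Metric.closedBall a (s * R') ⊆ t ∩ {x | DifferentiableAt ℝ f x} :=
    (Metric.closedBall_subset_ball h2).trans hball
  have hmem : ∀ w : Y, ‖w‖ ≤ R' → a + s • w ∈ Metric.closedBall a (s * R') := fun w hw => by
    rw [mem_closedBall_iff_norm, add_sub_cancel_left, norm_smul, Real.norm_of_nonneg hs.le]
    gcongr
  have key : ∀ w w' : Y, ‖w‖ ≤ R' → ‖w'‖ ≤ R' →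
      ‖(s⁻¹ • f (a + s • w) - fderiv ℝ f a w) - (s⁻¹ • f (a + s • w') - fderiv ℝ f a w')‖
        ≤ K * R' * s * ‖w - w'‖ := fun w w' hw hw' => by
    have h3 := (convex_closedBall a (s * R')).norm_image_sub_le_of_norm_hasFDerivWithin_le'
      (f := f) (f' := fderiv ℝ f) (φ := fderiv ℝ f a) (C := K * (s * R'))
      (fun x hx => (hsub hx).2.hasFDerivAt.hasFDerivWithinAt)
      (fun x hx => (hK.norm_sub_le (hsub hx).1 (mem_of_mem_nhds ht)).trans (by
        gcongr
        exact mem_closedBall_iff_norm.1 hx)) (hmem w' hw') (hmem w hw)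
    have h4 : (s⁻¹ • f (a + s • w) - fderiv ℝ f a w) -
        (s⁻¹ • f (a + s • w') - fderiv ℝ f a w') = s⁻¹ • (f (a + s • w) - f (a + s • w')
          - fderiv ℝ f a (a + s • w - (a + s • w'))) := by
      rw [add_sub_add_left_eq_sub, ← smul_sub, map_smul, smul_sub, smul_sub, inv_smul_smul₀ hs.ne',
        map_sub]
      abel
    rw [h4, norm_smul, norm_inv, Real.norm_of_nonneg hs.le]
    rw [add_sub_add_left_eq_sub, ← smul_sub, norm_smul, Real.norm_of_nonneg hs.le] at h3
    calc _ ≤ s⁻¹ * (K * (s * R') * (s * ‖w - w'‖)) := by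
          gcongr
          simpa only [add_sub_add_left_eq_sub, ← smul_sub] using h3
      _ = K * R' * s * ‖w - w'‖ := by field_simp
  intro y hy
  refine ⟨?_, fun y' hy' => (key y y' (hy.trans hRR) (hy'.trans hRR)).trans ?_⟩
  · have := key y 0 (hy.trans hRR) (by simpa using hR'pos.le)
    simp only [smul_zero, add_zero, h0, map_zero, sub_zero] at this
    refine this.trans ?_
    have : K * R' * s * ‖y‖ ≤ K * R' * s * (R' + 1) := by gcongr; linarith
    linarith
  · have : 0 ≤ K * R' * R' * s * ‖y - y'‖ := by positivity
    linarith

/-- A quantitative inverse function argument that needs no regularity in `θ`: on a fixed ball `Φ + E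
θ` stays Lipschitz close to `L`, hence covers `0` from a ball of radius `O(θ)`. Any derivative there
is close to `L`, hence injective. -/
theorem exists_zero_of_isSmallFamily [NormedSpace ℝ Y] [NormedSpace ℝ Z]
    [CompleteSpace Y] {Φ : Y → Z} {L : Y ≃L[ℝ] Z} {y₀ : Y}
    (hΦ : HasStrictFDerivAt Φ (L : Y →L[ℝ] Z) y₀) (h0 : Φ y₀ = 0) {E : ℝ → Y → Z}
    (hE : IsSmallFamily E) :
    ∃ C : ℝ, ∀ᶠ θ in 𝓝[>] (0 : ℝ), ∃ y, ‖y - y₀‖ ≤ C * θ ∧ Φ y + E θ y = 0 ∧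
      ∀ D : Y →L[ℝ] Z, HasFDerivAt (fun y => Φ y + E θ y) D y → Function.Injective D := by
  -- The summand `1` keeps `M` positive even when the spaces are trivial.
  set M : NNReal := ‖(L.symm : Z →L[ℝ] Y)‖₊ + 1 with hM
  have hMpos : 0 < M := by positivity
  have hLM : ∀ v, ‖v‖ ≤ M * ‖L v‖ := fun v => by
    have h1 := (L.symm : Z →L[ℝ] Y).le_opNorm (L v)
    have h2 : ‖(L.symm : Z →L[ℝ] Y)‖ ≤ M := by simp [hM]
    calc ‖v‖ = ‖(L.symm : Z →L[ℝ] Y) (L v)‖ := by simp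
      _ ≤ _ := h1.trans (by gcongr)
  let inv : (L : Y →L[ℝ] Z).NonlinearRightInverse :=
    { toFun := L.symm
      nnnorm := M
      bound' := fun y => by simpa using hLM (L.symm y)
      right_inv' := fun y => by simp }
  -- One `c` for the variation of `Φ` and one for that of `E θ`: the total `2 c = M⁻¹ / 2` is half
  -- of what invertibility tolerates.
  set c : NNReal := M⁻¹ / 4 with hc
  have hcpos : 0 < c := by positivity
  obtain ⟨s, hs, happ⟩ := hΦ.approximates_deriv_on_nhds (c := c) (Or.inr hcpos)
  obtain ⟨ε, hε, hball⟩ := Metric.nhds_basis_closedBall.mem_iff.1 hs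
  obtain ⟨C, hC⟩ := hE (‖y₀‖ + ε)
  have hbd : ∀ y ∈ Metric.closedBall y₀ ε, ‖y‖ ≤ ‖y₀‖ + ε := fun y hy => by
    have := norm_add_le y₀ (y - y₀)
    rw [add_sub_cancel] at this
    linarith [mem_closedBall_iff_norm.1 hy]
  have hMreal : (0 : ℝ) < M := hMpos
  -- A ball of radius `r` covers one of radius `r M⁻¹ / 2` around the value at `y₀`; this choice
  -- makes the latter `2 (|C| + 1) θ`, more than `‖E θ y₀‖`.
  refine ⟨4 * M * (|C| + 1), ?_⟩
  have h1 : ∀ᶠ θ in 𝓝[>] (0 : ℝ), (|C| + 1) * θ < c ∧ 4 * M * (|C| + 1) * θ < ε := by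
    refine Eventually.and ?_ ?_
    · have : Tendsto (fun θ : ℝ => (|C| + 1) * θ) (𝓝 0) (𝓝 ((|C| + 1) * 0)) :=
        (continuous_const.mul continuous_id).tendsto 0
      rw [mul_zero] at this
      exact (this.mono_left nhdsWithin_le_nhds).eventually_lt_const hcpos
    · have : Tendsto (fun θ : ℝ => 4 * M * (|C| + 1) * θ) (𝓝 0) (𝓝 (4 * M * (|C| + 1) * 0)) :=
        (continuous_const.mul continuous_id).tendsto 0
      rw [mul_zero] at this
      exact (this.mono_left nhdsWithin_le_nhds).eventually_lt_const hε
  filter_upwards [hC, h1, eventually_pos_nhdsGT] with θ hCθ hθ hθ0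
  have hCle : C * θ ≤ (|C| + 1) * θ := by gcongr; linarith [le_abs_self C]
  have happ2 : ∀ y ∈ Metric.closedBall y₀ ε, ∀ y' ∈ Metric.closedBall y₀ ε,
      ‖(Φ y + E θ y) - (Φ y' + E θ y') - L (y - y')‖ ≤ (2 * c : NNReal) * ‖y - y'‖ := by
    intro y hy y' hy'
    have e1 := happ y (hball hy) y' (hball hy')
    have e2 := (hCθ y (hbd y hy)).2 y' (hbd y' hy')
    have e3 : (Φ y + E θ y) - (Φ y' + E θ y') - L (y - y') =
      (Φ y - Φ y' - (L : Y →L[ℝ] Z) (y - y')) + (E θ y - E θ y') := by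
      simp only [ContinuousLinearEquiv.coe_coe]; abel
    rw [e3]
    refine (norm_add_le _ _).trans ?_
    rw [NNReal.coe_mul, NNReal.coe_ofNat]
    have e4 : C * θ * ‖y - y'‖ ≤ c * ‖y - y'‖ := by
      gcongr
      linarith [hθ.1]
    linarith
  have happ3 : ApproximatesLinearOn (fun y => Φ y + E θ y) (L : Y →L[ℝ] Z)
      (Metric.closedBall y₀ ε) (2 * c) := fun y hy y' hy' => happ2 y hy y' hy'
  set r : ℝ := 4 * M * (|C| + 1) * θ with hr
  have hrpos : 0 < r := by positivity
  have hsurj := happ3.surjOn_closedBall_of_nonlinearRightInverse inv hrpos.le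
    (Metric.closedBall_subset_closedBall hθ.2.le)
  have hcM : (M : ℝ)⁻¹ - ((2 * c : NNReal) : ℝ) = (M : ℝ)⁻¹ / 2 := by
    rw [hc]; push_cast; ring
  have hmem : (0 : Z) ∈ Metric.closedBall (Φ y₀ + E θ y₀)
      (((inv.nnnorm : ℝ)⁻¹ - ((2 * c : NNReal) : ℝ)) * r) := by
    rw [mem_closedBall_iff_norm, h0, zero_add, zero_sub, norm_neg]
    refine ((hCθ y₀ (by linarith)).1.trans hCle).trans ?_
    change _ ≤ ((M : ℝ)⁻¹ - ((2 * c : NNReal) : ℝ)) * r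
    rw [hcM, hr]
    have : (M : ℝ)⁻¹ / 2 * (4 * M * (|C| + 1) * θ) = 2 * ((|C| + 1) * θ) := by
      field_simp; ring
    rw [this]
    have : 0 ≤ (|C| + 1) * θ := by positivity
    linarith
  obtain ⟨y, hy, hy0⟩ := hsurj hmem
  refine ⟨y, mem_closedBall_iff_norm.1 hy, hy0, fun D hD => ?_⟩
  have hDL : ‖D - (L : Y →L[ℝ] Z)‖ ≤ (2 * c : NNReal) := by
    refine (hD.sub (L : Y →L[ℝ] Z).hasFDerivAt).le_of_lipschitzOn
      (s := Metric.closedBall y₀ ε) ?_ ?_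
    · refine Metric.closedBall_mem_nhds_of_mem ?_
      rw [mem_ball_iff_norm]
      exact (mem_closedBall_iff_norm.1 hy).trans_lt hθ.2
    · refine LipschitzOnWith.of_dist_le_mul fun u hu u' hu' => ?_
      rw [dist_eq_norm, dist_eq_norm]
      refine le_trans (le_of_eq ?_) (happ2 u hu u' hu')
      congr 1
      simp only [Pi.sub_apply, ContinuousLinearEquiv.coe_coe, map_sub]
      abel
  rw [injective_iff_map_eq_zero]
  intro v hv
  by_contra hne
  have hvpos : 0 < ‖v‖ := norm_pos_iff.2 hne
  have e1 : ‖L v‖ ≤ (2 * c : NNReal) * ‖v‖ := by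
    have := ((D - (L : Y →L[ℝ] Z)).le_opNorm v).trans
      (mul_le_mul_of_nonneg_right hDL (norm_nonneg v))
    simpa [hv] using this
  have e2 := (hLM v).trans (mul_le_mul_of_nonneg_left e1 hMreal.le)
  have e3 : (M : ℝ) * ((2 * c : NNReal) * ‖v‖) = ‖v‖ / 2 := by
    rw [hc]; push_cast; field_simp; ring
  rw [e3] at e2
  linarith

end SmallFamily

/-! ### Rank one corrections of an endomorphism of corank one. -/

section RankOne

variable {V : Type*} [AddCommGroup V] [Module ℝ V] [FiniteDimensional ℝ V]

/-- Take `l` nonzero on the one-dimensional kernel. As `e` is outside the range, `D w + l w • e = 0`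
forces `l w = 0`, then `D w = 0`, hence `w = 0`. -/
theorem exists_injective_add_smulRight {D : V →ₗ[ℝ] V} {e : V}
    (hD : Module.finrank ℝ (LinearMap.range D) + 1 = Module.finrank ℝ V)
    (he : e ∉ LinearMap.range D) :
    ∃ l : V →ₗ[ℝ] ℝ, Function.Injective (D + l.smulRight e) := by
  have hk : Module.finrank ℝ (LinearMap.ker D) = 1 := by
    have := D.finrank_range_add_finrank_ker
    omega
  obtain ⟨⟨v, hvk⟩, hv0, hv⟩ := finrank_eq_one_iff'.1 hk
  have hv0' : v ∉ (⊥ : Submodule ℝ V) := by simpa using hv0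
  obtain ⟨l, hl, -⟩ := Submodule.exists_le_ker_of_notMem hv0'
  refine ⟨l, (injective_iff_map_eq_zero _).2 fun w hw => ?_⟩
  have hw' : D w + l w • e = 0 := by simpa using hw
  have hlw : l w = 0 := by
    by_contra hne
    refine he ⟨-(l w)⁻¹ • w, ?_⟩
    rw [map_smul, eq_neg_of_add_eq_zero_left hw', smul_neg, neg_smul, neg_neg,
      inv_smul_smul₀ hne]
  rw [hlw, zero_smul, add_zero] at hw'
  obtain ⟨c, hc⟩ := hv ⟨w, hw'⟩
  have hc' : c • v = w := congrArg Subtype.val hc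
  rw [← hc', map_smul, smul_eq_mul] at hlw
  rw [← hc', (mul_eq_zero.1 hlw).resolve_right hl, zero_smul]

/-- The way back: surjectivity of the corrected map makes the line through `e` a complement of the
range of `D`. -/
theorem finrank_range_add_one_of_injective_add_smulRight {D : V →ₗ[ℝ] V} {e : V}
    (he : e ∉ LinearMap.range D) {l : V →ₗ[ℝ] ℝ} (hl : Function.Injective (D + l.smulRight e)) :
    Module.finrank ℝ (LinearMap.range D) + 1 = Module.finrank ℝ V := by
  have he0 : e ≠ 0 := fun h => he (h ▸ zero_mem _)
  have hsurj := LinearMap.injective_iff_surjective.1 hl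
  rw [← finrank_span_singleton (K := ℝ) he0]
  refine Submodule.finrank_add_eq_of_isCompl ⟨?_, ?_⟩
  · exact ((Submodule.disjoint_span_singleton' he0).2 he)
  · rw [codisjoint_iff, eq_top_iff]
    intro x _
    obtain ⟨w, rfl⟩ := hsurj x
    exact Submodule.add_mem_sup ⟨w, rfl⟩ (Submodule.mem_span_singleton.2 ⟨l w, rfl⟩)

end RankOne

end Families

/-! ### The central configuration map: centre of mass, torque and rotations. -/

section Kernel

open Filter Topology
open scoped RealInnerProductSpace

/-- The Newtonian force field `x / |x|³`. -/
def newtonKernel (x : Plane) : Plane := (‖x‖ ^ 3)⁻¹ • x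

theorem newtonKernel_zero : newtonKernel 0 = 0 := by simp [newtonKernel]

theorem newtonKernel_neg (x : Plane) : newtonKernel (-x) = -newtonKernel x := by
  simp [newtonKernel]

theorem newtonKernel_sub_comm (x y : Plane) : newtonKernel (x - y) = -newtonKernel (y - x) := by
  rw [← newtonKernel_neg, neg_sub]

theorem newtonKernel_smul {θ : ℝ} (hθ : 0 < θ) (x : Plane) :
    newtonKernel (θ • x) = (θ ^ 2)⁻¹ • newtonKernel x := by
  simp only [newtonKernel, norm_smul, Real.norm_of_nonneg hθ.le, smul_smul]
  congr 1
  field_simp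

theorem contDiffAt_newtonKernel {x : Plane} (hx : x ≠ 0) {n : WithTop ℕ∞} :
    ContDiffAt ℝ n newtonKernel x :=
  (((contDiffAt_norm ℝ hx).pow 3).inv (by simpa using hx)).smul contDiffAt_id

theorem eq_zero_of_eq_neg (𝕜 : Type*) [Field 𝕜] [CharZero 𝕜] {M : Type*} [AddCommGroup M]
    [Module 𝕜 M] {x : M} (h : x = -x) : x = 0 := by
  have h2 : (2 : 𝕜) • x = 0 := by
    rw [two_smul]
    nth_rewrite 1 [h]
    exact neg_add_cancel x
  exact (smul_eq_zero.1 h2).resolve_left two_ne_zero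

section Config

variable {ι : Type*} [Fintype ι] [DecidableEq ι]

theorem ccMap_apply (m : ι → ℝ) (q : ι → Plane) (i : ι) :
    ccMap m q i = q i - ∑ j, m j • newtonKernel (q i - q j) := by
  rw [ccMap, ← Finset.add_sum_erase _ _ (Finset.mem_univ i), sub_self, newtonKernel_zero,
    smul_zero, zero_add]
  simp only [newtonKernel, smul_smul, div_eq_mul_inv]

theorem contDiffAt_ccMap (m : ι → ℝ) {q : ι → Plane} (hq : Function.Injective q)
    {n : WithTop ℕ∞} : ContDiffAt ℝ n (ccMap m) q := by
  rw [contDiffAt_pi]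
  intro i
  simp only [ccMap_apply]
  refine (contDiff_apply ℝ Plane i).contDiffAt.sub (ContDiffAt.sum fun j _ => ContDiffAt.const_smul _ ?_)
  by_cases hij : j = i
  · subst hij
    simpa [newtonKernel_zero] using contDiffAt_const
  · exact ContDiffAt.comp (g := newtonKernel) (f := fun x : ι → Plane => x i - x j) q
      (contDiffAt_newtonKernel (sub_ne_zero.2 fun h => hij (hq h).symm))
      ((contDiff_apply ℝ Plane i).sub (contDiff_apply ℝ Plane j)).contDiffAt

/-- Action and reaction cancel in pairs. Consequently a zero of `ccMap` automatically has its centre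
of mass at the origin. -/
theorem sum_smul_ccMap (m : ι → ℝ) (q : ι → Plane) :
    ∑ i, m i • ccMap m q i = ∑ i, m i • q i := by
  simp only [ccMap_apply, smul_sub, Finset.sum_sub_distrib, Finset.smul_sum, smul_smul]
  have h : ∑ i, ∑ j, (m i * m j) • newtonKernel (q i - q j) = 0 := by
    refine eq_zero_of_eq_neg ℝ (Finset.sum_comm.trans ?_)
    simp only [← Finset.sum_neg_distrib]
    refine Finset.sum_congr rfl fun i _ => Finset.sum_congr rfl fun j _ => ?_
    rw [newtonKernel_sub_comm, smul_neg, mul_comm]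
  rw [h, sub_zero]

theorem isNormalizedCC_iff {m : ι → ℝ} (hm : ∀ i, 0 < m i) {q : ι → Plane} :
    IsNormalizedCC m q ↔ Function.Injective q ∧ ccMap m q = 0 := by
  have key : ∀ i, ((1 * m i) • q i = ∑ j ∈ Finset.univ.erase i,
      (m i * m j / ‖q i - q j‖ ^ 3) • (q i - q j)) ↔ ccMap m q i = 0 := fun i => by
    rw [ccMap, sub_eq_zero]
    refine Iff.trans ?_ (smul_right_injective Plane (hm i).ne').eq_iff
    rw [one_mul]
    simp only [Finset.smul_sum, smul_smul, mul_div_assoc]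
  constructor
  · rintro ⟨⟨hinj, -, h⟩, hc⟩
    refine ⟨hinj, funext fun i => (key i).1 ?_⟩
    simpa [hc] using h i
  · rintro ⟨hinj, h⟩
    have hc : centerOfMass m q = 0 := by
      rw [centerOfMass, ← sum_smul_ccMap, h]
      simp
    refine ⟨⟨hinj, one_pos, fun i => ?_⟩, hc⟩
    rw [hc, sub_zero]
    exact (key i).2 (congrFun h i)

/-- The total torque `∑ mᵢ qᵢ × wᵢ` of the forces `mᵢ wᵢ` applied at the points `qᵢ`. -/
def torque (m : ι → ℝ) (q w : ι → Plane) : ℝ :=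
  ∑ i, m i * (q i 0 * w i 1 - q i 1 * w i 0)

/-- The velocity field of the rotation of the plane about the origin. -/
def rotationField (q : ι → Plane) : ι → Plane := fun i => !₂[-q i 1, q i 0]

theorem torque_rotationField {ι : Type*} [Fintype ι] (m : ι → ℝ) (q : ι → Plane) :
    torque m q (rotationField q) = ∑ i, m i * (q i 0 ^ 2 + q i 1 ^ 2) := by
  simp only [torque, rotationField]
  refine Finset.sum_congr rfl fun i _ => ?_
  change m i * (q i 0 * q i 0 - q i 1 * -q i 1) = _
  ring

theorem torque_rotationField_pos {ι : Type*} [Fintype ι] {m : ι → ℝ} (hm : ∀ i, 0 < m i) {q : ι → Plane} (hq : q ≠ 0) :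
    0 < torque m q (rotationField q) := by
  rw [torque_rotationField]
  obtain ⟨i, hi⟩ := Function.ne_iff.1 hq
  refine Finset.sum_pos' (fun j _ => mul_nonneg (hm j).le (by positivity))
    ⟨i, Finset.mem_univ i, mul_pos (hm i) ?_⟩
  by_contra hle
  refine hi ?_
  ext c
  fin_cases c
  · simp only [Fin.zero_eta, Pi.zero_apply, PiLp.zero_apply]
    nlinarith [sq_nonneg (q i 0), sq_nonneg (q i 1)]
  · simp only [Fin.mk_one, Pi.zero_apply, PiLp.zero_apply]
    nlinarith [sq_nonneg (q i 0), sq_nonneg (q i 1)]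

/-- The central term `qᵢ` exerts no torque, and the pair forces, directed along `qᵢ - qⱼ`, cancel by
antisymmetry. -/
theorem torque_ccMap (m : ι → ℝ) (q : ι → Plane) : torque m q (ccMap m q) = 0 := by
  have h : ∀ i, m i * (q i 0 * ccMap m q i 1 - q i 1 * ccMap m q i 0) =
      ∑ j, m i * m j * (‖q i - q j‖ ^ 3)⁻¹ * (q i 0 * q j 1 - q i 1 * q j 0) := fun i => by
    have e : ∀ c : Fin 2, ccMap m q i c =
        q i c - ∑ j, m j * ((‖q i - q j‖ ^ 3)⁻¹ * (q i c - q j c)) := fun c => by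
      rw [ccMap_apply]
      simp [newtonKernel, WithLp.ofLp_sum]
    rw [e, e, mul_sub (q i 0), mul_sub (q i 1), mul_comm (q i 1) (q i 0),
      sub_sub_sub_cancel_left, Finset.mul_sum, Finset.mul_sum, ← Finset.sum_sub_distrib,
      Finset.mul_sum]
    refine Finset.sum_congr rfl fun j _ => ?_
    ring
  rw [torque, Finset.sum_congr rfl fun i _ => h i]
  refine eq_zero_of_eq_neg ℝ (Finset.sum_comm.trans ?_)
  simp only [← Finset.sum_neg_distrib]
  refine Finset.sum_congr rfl fun i _ => Finset.sum_congr rfl fun j _ => ?_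
  rw [norm_sub_rev]
  ring

/-- Differentiate the torque identity along `q + t v`; the terms where `q` is differentiated carry
the factor `ccMap m q = 0`. -/
theorem torque_fderiv_ccMap (m : ι → ℝ) {q : ι → Plane} (hq : Function.Injective q)
    (h0 : ccMap m q = 0) (v : ι → Plane) : torque m q (fderiv ℝ (ccMap m) q v) = 0 := by
  have hF : HasDerivAt (fun t : ℝ => ccMap m (q + t • v)) (fderiv ℝ (ccMap m) q v) 0 := by
    have h1 : HasFDerivAt (ccMap m) (fderiv ℝ (ccMap m) q) (q + (0 : ℝ) • v) := by
      rw [zero_smul, add_zero]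
      exact ((contDiffAt_ccMap m hq (n := 1)).differentiableAt (by norm_num)).hasFDerivAt
    have h2 : HasDerivAt (fun t : ℝ => q + t • v) v 0 := by
      simpa using ((hasDerivAt_id (0 : ℝ)).smul_const v).const_add q
    exact h1.comp_hasDerivAt (0 : ℝ) h2
  have hq' : ∀ (i : ι) (c : Fin 2), HasDerivAt (fun t : ℝ => (q + t • v) i c) (v i c) 0 :=
    fun i c => by
      simpa using ((hasDerivAt_id (0 : ℝ)).mul_const (v i c)).const_add (q i c)
  have hF' : ∀ (i : ι) (c : Fin 2), HasDerivAt (fun t : ℝ => ccMap m (q + t • v) i c)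
      (fderiv ℝ (ccMap m) q v i c) 0 := fun i c => by
    have h1 := hasDerivAt_pi.1 hF i
    exact ((EuclideanSpace.proj c : Plane →L[ℝ] ℝ).hasFDerivAt.comp_hasDerivAt (0 : ℝ) h1)
  have hT : HasDerivAt (fun t : ℝ => torque m (q + t • v) (ccMap m (q + t • v)))
      (torque m q (fderiv ℝ (ccMap m) q v)) 0 := by
    have := HasDerivAt.fun_sum (u := Finset.univ) fun i _ =>
      ((((hq' i 0).mul (hF' i 1)).sub ((hq' i 1).mul (hF' i 0))).const_mul (m i))
    refine this.congr_deriv ?_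
    refine Finset.sum_congr rfl fun i _ => ?_
    simp [h0]
  simp only [torque_ccMap] at hT
  exact hT.unique (hasDerivAt_const _ _)

theorem notMem_range_fderiv_ccMap {m : ι → ℝ} {q e : ι → Plane} (hq : Function.Injective q)
    (h0 : ccMap m q = 0) (he : torque m q e ≠ 0) :
    e ∉ LinearMap.range (fderiv ℝ (ccMap m) q).toLinearMap := by
  rintro ⟨v, rfl⟩
  exact he (torque_fderiv_ccMap m hq h0 v)

theorem finrank_config {ι : Type*} [Fintype ι] : Module.finrank ℝ (ι → Plane) = 2 * Fintype.card ι := by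
  rw [Module.finrank_pi_fintype]
  simp [mul_comm]

/-- Distinct points all at the origin mean at most one body; then `F` is the identity and its rank
is `2 n`, not `2 n - 1`. -/
theorem IsNondegenerateNormalizedCC.ne_zero {m : ι → ℝ} {q : ι → Plane}
    (h : IsNondegenerateNormalizedCC m q) : q ≠ 0 := by
  rintro rfl
  have hsub : Subsingleton ι := ⟨fun i j => h.1.1.1 rfl⟩
  have hid : ccMap m = id := by
    funext q i
    rw [ccMap_apply, Finset.sum_eq_zero, sub_zero, id]
    intro j _
    rw [Subsingleton.elim j i, sub_self, newtonKernel_zero, smul_zero]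
  have h2 := h.2
  rw [hid, fderiv_id, ← finrank_config (ι := ι)] at h2
  have : LinearMap.range ((ContinuousLinearMap.id ℝ (ι → Plane)).toLinearMap) = ⊤ :=
    LinearMap.range_id
  rw [this, finrank_top] at h2
  omega

end Config

end Kernel

/-! ### Gradients and Hessians of the restricted and the induced potentials. -/

section Gradients

open Filter Topology
open scoped RealInnerProductSpace

/-- The Euclidean inner product of the plane as a continuous bilinear form. -/
def planeInner : Plane →L[ℝ] Plane →L[ℝ] ℝ := innerSL ℝ

@[simp]
theorem planeInner_apply (x y : Plane) : planeInner x y = ⟪x, y⟫ := rfl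

theorem hasFDerivAt_inv_norm {x : Plane} (hx : x ≠ 0) :
    HasFDerivAt (fun x : Plane => ‖x‖⁻¹) (-planeInner (newtonKernel x)) x := by
  have hn : ‖x‖ ≠ 0 := norm_ne_zero_iff.2 hx
  have h1 : HasFDerivAt (fun x : Plane => ‖x‖ ^ 2) (2 • planeInner x) x :=
    (hasStrictFDerivAt_norm_sq x).hasFDerivAt
  have h2 : HasFDerivAt (fun x : Plane => (√(‖x‖ ^ 2))⁻¹) _ x :=
    (hasDerivAt_inv (by simpa using hx)).comp_hasFDerivAt x (h1.sqrt (pow_ne_zero 2 hn))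
  simp only [Real.sqrt_sq (norm_nonneg _)] at h2
  refine h2.congr_fderiv ?_
  ext v
  simp [newtonKernel]
  field_simp

theorem hasFDerivAt_const_div_norm {G : Type*} [NormedAddCommGroup G] [NormedSpace ℝ G]
    {f : G → Plane} {f' : G →L[ℝ] Plane} {x : G} (hf : HasFDerivAt f f' x) (hx : f x ≠ 0) (c : ℝ) :
    HasFDerivAt (fun y => c / ‖f y‖) (-(c • (planeInner (newtonKernel (f x))).comp f')) x := by
  have h := ((hasFDerivAt_inv_norm hx).comp x hf).const_mul c
  simpa only [Function.comp_def, div_eq_mul_inv, smul_neg, ContinuousLinearMap.neg_comp] using h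

/-- The gradient in `p` of the potential of the restricted problem. -/
def restrictedGradient {ι : Type*} [Fintype ι] (m : ι → ℝ) (q : ι → Plane) (p : Plane) : Plane :=
  p - ∑ i, m i • newtonKernel (p - q i)

theorem eventually_injective {ι : Type*} [Finite ι] {q : ι → Plane} (hq : Function.Injective q) :
    ∀ᶠ q' in 𝓝 q, Function.Injective q' := by
  have : ∀ᶠ q' in 𝓝 q, ∀ i j, q' i = q' j → i = j := by
    refine eventually_all.2 fun i => eventually_all.2 fun j => ?_
    by_cases hij : i = j
    · exact Eventually.of_forall fun _ _ => hij
    · filter_upwards [(isOpen_ne_fun (f := fun q' : ι → Plane => q' i) (g := fun q' => q' j)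
        (continuous_apply i) (continuous_apply j)).mem_nhds
          (show q i ≠ q j from fun e => hij (hq e))] with q' hq' h
      exact absurd h hq'
  filter_upwards [this] with q' hq' i j using hq' i j

section Restricted

variable {ι : Type*} [Fintype ι] {m : ι → ℝ} {q : ι → Plane} {x : Plane}

theorem hasFDerivAt_restrictedPotential (hx : ∀ i, x ≠ q i) :
    HasFDerivAt (restrictedPotential m q) (planeInner (restrictedGradient m q x)) x := by
  have h1 : HasFDerivAt (fun x : Plane => ‖x‖ ^ 2) (2 • planeInner x) x :=
    (hasStrictFDerivAt_norm_sq x).hasFDerivAt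
  have h2 : ∀ i ∈ Finset.univ, HasFDerivAt (fun p => m i / ‖p - q i‖)
      (-(m i • planeInner (newtonKernel (x - q i)))) x := fun i _ =>
    hasFDerivAt_const_div_norm ((hasFDerivAt_id x).sub_const (q i)) (sub_ne_zero.2 (hx i)) (m i)
  have h3 := (h1.mul_const (2 : ℝ)⁻¹).add (HasFDerivAt.fun_sum h2)
  refine (h3.congr_fderiv ?_)
  ext v
  simp [restrictedGradient]
  ring

theorem eventually_ne_all (hx : ∀ i, x ≠ q i) : ∀ᶠ p in 𝓝 x, ∀ i, p ≠ q i :=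
  eventually_all.2 fun i => isOpen_ne.mem_nhds (hx i)

/-- Joint smoothness is needed because the heavy bodies move together with the cluster. -/
theorem contDiffAt_restrictedGradient_uncurry (hx : ∀ i, x ≠ q i) {n : WithTop ℕ∞} :
    ContDiffAt ℝ n (fun z : (ι → Plane) × Plane => restrictedGradient m z.1 z.2) (q, x) := by
  refine contDiffAt_snd.sub (ContDiffAt.sum fun i _ => ContDiffAt.const_smul _ ?_)
  refine ContDiffAt.comp (g := newtonKernel) (f := fun z : (ι → Plane) × Plane => z.2 - z.1 i) _
    (contDiffAt_newtonKernel (sub_ne_zero.2 (hx i))) ?_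
  exact (contDiff_snd.sub ((contDiff_apply ℝ Plane i).comp contDiff_fst)).contDiffAt

theorem differentiableAt_restrictedGradient (hx : ∀ i, x ≠ q i) :
    DifferentiableAt ℝ (restrictedGradient m q) x :=
  ((contDiffAt_restrictedGradient_uncurry hx (n := 1)).differentiableAt (by norm_num)).comp x
    ((differentiableAt_const q).prodMk differentiableAt_id)

theorem restrictedHessian_apply (hx : ∀ i, x ≠ q i) (u v : Plane) :
    restrictedHessian m q x u v = ⟪fderiv ℝ (restrictedGradient m q) x u, v⟫ := by
  have h1 : fderiv ℝ (restrictedPotential m q) =ᶠ[𝓝 x]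
      fun p => planeInner (restrictedGradient m q p) := by
    filter_upwards [eventually_ne_all hx] with p hp
    exact (hasFDerivAt_restrictedPotential hp).fderiv
  have h2 := planeInner.hasFDerivAt.comp x (differentiableAt_restrictedGradient (m := m) hx).hasFDerivAt
  rw [restrictedHessian, h1.fderiv_eq]
  erw [h2.fderiv]
  rfl

theorem restrictedHessian_comm (hx : ∀ i, x ≠ q i) (u v : Plane) :
    restrictedHessian m q x u v = restrictedHessian m q x v u := by
  refine second_derivative_symmetric_of_eventually (x := x) (f := restrictedPotential m q)
    (f' := fun p => planeInner (restrictedGradient m q p)) ?_ ?_ u v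
  · filter_upwards [eventually_ne_all hx] with p hp
    exact hasFDerivAt_restrictedPotential hp
  · refine (planeInner.hasFDerivAt.comp x
      (differentiableAt_restrictedGradient (m := m) hx).hasFDerivAt).congr_fderiv ?_
    ext u v
    rw [restrictedHessian_apply hx]
    rfl

theorem IsRestrictedRelEquilibrium.restrictedGradient_eq_zero
    (h : IsRestrictedRelEquilibrium m q x) : restrictedGradient m q x = 0 := by
  have h1 := h.2
  rw [(hasFDerivAt_restrictedPotential h.1).fderiv] at h1
  have h2 := congrArg (fun L => L (restrictedGradient m q x)) h1
  simpa using h2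

end Restricted

section Induced

variable {N k : ℕ} {m : Fin N → ℝ} {q : Fin N → Plane} {x : Plane} {μ : Fin k → ℝ}
  {p : Fin k → Plane}

/-- The gradient of the induced anisotropic potential with respect to the mass inner product. -/
def inducedGradient (m : Fin N → ℝ) (q : Fin N → Plane) (x : Plane) (μ : Fin k → ℝ)
    (p : Fin k → Plane) : Fin k → Plane := fun j =>
  fderiv ℝ (restrictedGradient m q) x (p j) - ∑ l, μ l • newtonKernel (p j - p l)

/-- The mass inner product on configurations, as a map to the dual space. -/
def massInner (μ : Fin k → ℝ) : (Fin k → Plane) →L[ℝ] (Fin k → Plane) →L[ℝ] ℝ :=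
  ∑ j, μ j • ((ContinuousLinearMap.compL ℝ (Fin k → Plane) Plane ℝ).flip
    (ContinuousLinearMap.proj j)).comp (planeInner.comp (ContinuousLinearMap.proj j))

theorem massInner_apply (μ : Fin k → ℝ) (u v : Fin k → Plane) :
    massInner μ u v = ∑ j, μ j * ⟪u j, v j⟫ := by
  simp [massInner]

theorem massInner_injective (hμ : ∀ j, 0 < μ j) : Function.Injective (massInner μ) := by
  refine (injective_iff_map_eq_zero _).2 fun u hu => ?_
  have h := congrArg (fun L => L u) hu
  simp only [massInner_apply, zero_apply] at h
  rw [Finset.sum_eq_zero_iff_of_nonneg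
    fun j _ => mul_nonneg (hμ j).le real_inner_self_nonneg] at h
  funext j
  simpa [(hμ j).ne'] using h j (Finset.mem_univ j)

theorem contDiffAt_inducedGradient (hp : Function.Injective p) {n : WithTop ℕ∞} :
    ContDiffAt ℝ n (inducedGradient m q x μ) p := by
  have h := contDiffAt_ccMap μ hp (n := n)
  have h1 : inducedGradient m q x μ = fun p j =>
      fderiv ℝ (restrictedGradient m q) x (p j) - (p j - ccMap μ p j) := by
    funext p j
    rw [inducedGradient, ccMap_apply, sub_sub_cancel]
  rw [h1, contDiffAt_pi]
  intro j
  exact ((ContinuousLinearMap.contDiff _).comp (contDiff_apply ℝ Plane j)).contDiffAt.sub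
    ((contDiff_apply ℝ Plane j).contDiffAt.sub (contDiffAt_pi.1 h j))

theorem hasFDerivAt_inducedPotential (hx : ∀ i, x ≠ q i) (hp : Function.Injective p) :
    HasFDerivAt (inducedPotential m q x μ) (massInner μ (inducedGradient m q x μ p)) p := by
  have hproj : ∀ j : Fin k, HasFDerivAt (fun p : Fin k → Plane => p j)
      (ContinuousLinearMap.proj (R := ℝ) j) p := fun j => hasFDerivAt_apply j p
  have h1 : ∀ j ∈ Finset.univ, HasFDerivAt
      (fun p : Fin k → Plane => μ j / 2 * restrictedHessian m q x (p j) (p j)) _ p := fun j _ =>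
    ((restrictedHessian m q x).hasFDerivAt_of_bilinear (hproj j) (hproj j)).const_mul (μ j / 2)
  have h2 : ∀ i ∈ Finset.univ, ∀ j ∈ Finset.Ioi i, HasFDerivAt
      (fun p : Fin k → Plane => μ i * μ j / ‖p i - p j‖) _ p := fun i _ j hj =>
    hasFDerivAt_const_div_norm ((hproj i).sub (hproj j))
      (sub_ne_zero.2 fun h => (Finset.mem_Ioi.1 hj).ne (hp h)) (μ i * μ j)
  refine ((HasFDerivAt.fun_sum h1).add
    (HasFDerivAt.fun_sum fun i hi => HasFDerivAt.fun_sum (h2 i hi))).congr_fderiv ?_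
  ext v
  -- Oddness of the kernel splits each pair `i < j` into its two ordered pairs; the diagonal may be
  -- added since the kernel is `0` at `0`.
  have h3 : ∑ i, ∑ j ∈ Finset.Ioi i, (μ i * μ j) * ⟪newtonKernel (p i - p j), v i - v j⟫ =
      ∑ i, ∑ j, (μ i * μ j) * ⟪newtonKernel (p i - p j), v i⟫ := by
    have h4 := Finset.sum_sum_Ioi_add_eq_sum_sum_off_diag
      fun j i : Fin k => (μ i * μ j) * ⟪newtonKernel (p i - p j), v i⟫
    refine Eq.trans ?_ (h4.trans ?_)
    · refine Finset.sum_congr rfl fun i _ => Finset.sum_congr rfl fun j _ => ?_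
      rw [newtonKernel_sub_comm (p j) (p i), inner_neg_left, inner_sub_right]
      ring
    · refine Finset.sum_congr rfl fun i _ => ?_
      refine Finset.sum_subset (Finset.subset_univ _) fun j _ hj => ?_
      have : j = i := by simpa using hj
      rw [this, sub_self, newtonKernel_zero, inner_zero_left, mul_zero]
  have h5 : massInner μ (inducedGradient m q x μ p) v =
      ∑ j, μ j * restrictedHessian m q x (p j) (v j) -
        ∑ i, ∑ j, (μ i * μ j) * ⟪newtonKernel (p i - p j), v i⟫ := by
    rw [massInner_apply, ← Finset.sum_sub_distrib]
    refine Finset.sum_congr rfl fun j _ => ?_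
    rw [inducedGradient, inner_sub_left, mul_sub, sum_inner, Finset.mul_sum,
      restrictedHessian_apply hx]
    simp only [real_inner_smul_left, mul_assoc]
  rw [h5, ← h3, sub_eq_add_neg]
  simp only [add_apply, sum_apply]
  congr 1
  · refine Finset.sum_congr rfl fun j _ => ?_
    simp [restrictedHessian_comm hx (v j) (p j)]
    ring
  · simp [Finset.sum_neg_distrib, inner_sub_right]

theorem IsInducedCC.inducedGradient_eq_zero (hμ : ∀ j, 0 < μ j) (hx : ∀ i, x ≠ q i)
    (h : IsInducedCC m q x μ p) : inducedGradient m q x μ p = 0 := by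
  have h1 := h.2
  rw [(hasFDerivAt_inducedPotential hx h.1).fderiv] at h1
  exact massInner_injective hμ (h1.trans (map_zero _).symm)

/-- The Hessian factors as `massInner μ` after the derivative of the gradient, so its injectivity
passes to the inner factor. -/
theorem IsNondegenerateInducedCC.injective_fderiv_inducedGradient (hx : ∀ i, x ≠ q i)
    (h : IsNondegenerateInducedCC m q x μ p) :
    Function.Injective (fderiv ℝ (inducedGradient m q x μ) p) := by
  have h1 : fderiv ℝ (inducedPotential m q x μ) =ᶠ[𝓝 p]
      fun p => massInner μ (inducedGradient m q x μ p) := by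
    filter_upwards [eventually_injective h.1.1] with p' hp'
    exact (hasFDerivAt_inducedPotential hx hp').fderiv
  have h2 : HasFDerivAt (fun p => massInner μ (inducedGradient m q x μ p))
      ((massInner μ).comp (fderiv ℝ (inducedGradient m q x μ) p)) p :=
    (massInner μ).hasFDerivAt.comp p
      ((contDiffAt_inducedGradient h.1.1 (n := 1)).differentiableAt (by norm_num)).hasFDerivAt
  have h3 := h.2.1
  rw [h1.fderiv_eq, h2.fderiv] at h3
  exact Function.Injective.of_comp (f := massInner μ) h3

end Induced

end Gradients

/-! ### Blow-up of the equations and their limit. -/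

section Rescaled

open Filter Topology

section BlowUp

variable {N k : ℕ}

theorem torque_smul {ι : Type*} [Fintype ι] (m : ι → ℝ) (q w : ι → Plane) (c : ℝ) :
    torque m q (c • w) = c * torque m q w := by
  simp only [torque, Finset.mul_sum, Pi.smul_apply, PiLp.smul_apply, smul_eq_mul]
  exact Finset.sum_congr rfl fun i _ => by ring

theorem torque_sumElim_zero (m : Fin N → ℝ) (μ : Fin k → ℝ) (z : Fin N ⊕ Fin k → Plane)
    (e : Fin N → Plane) :
    torque (Sum.elim m μ) z (Sum.elim e 0) = torque m (z ∘ Sum.inl) e := by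
  simp [torque, Fintype.sum_sum_type]

theorem ccMap_sumElim_inl (m : Fin N → ℝ) (μ : Fin k → ℝ) (q : Fin N → Plane)
    (p : Fin k → Plane) (i : Fin N) :
    ccMap (Sum.elim m μ) (Sum.elim q p) (Sum.inl i) =
      ccMap m q i - ∑ l, μ l • newtonKernel (q i - p l) := by
  simp only [ccMap_apply, Fintype.sum_sum_type, Sum.elim_inl, Sum.elim_inr]
  abel

theorem ccMap_sumElim_inr (m : Fin N → ℝ) (μ : Fin k → ℝ) (q : Fin N → Plane)
    (p : Fin k → Plane) (j : Fin k) :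
    ccMap (Sum.elim m μ) (Sum.elim q p) (Sum.inr j) =
      restrictedGradient m q (p j) - ∑ l, μ l • newtonKernel (p j - p l) := by
  simp only [ccMap_apply, restrictedGradient, Fintype.sum_sum_type, Sum.elim_inl, Sum.elim_inr]
  abel

/-- The restriction of a configuration of `N + k` bodies to the first `N` bodies. -/
def restrictInl (N k : ℕ) : (Fin N ⊕ Fin k → Plane) →L[ℝ] (Fin N → Plane) :=
  ContinuousLinearMap.pi fun i => ContinuousLinearMap.proj (Sum.inl i)

/-- The restriction of a configuration of `N + k` bodies to the last `k` bodies. -/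
def restrictInr (N k : ℕ) : (Fin N ⊕ Fin k → Plane) →L[ℝ] (Fin k → Plane) :=
  ContinuousLinearMap.pi fun j => ContinuousLinearMap.proj (Sum.inr j)

theorem restrictInl_apply (z : Fin N ⊕ Fin k → Plane) : restrictInl N k z = z ∘ Sum.inl := rfl

/-- The central configuration map, corrected along the direction `e` by a functional `l` so as to
remove the degeneracy coming from rotations. -/
def augmentedMap (M : Fin N ⊕ Fin k → ℝ) (q₀ : Fin N → Plane) (l : (Fin N → Plane) →L[ℝ] ℝ)
    (e : Fin N → Plane) (z : Fin N ⊕ Fin k → Plane) : Fin N ⊕ Fin k → Plane :=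
  ccMap M z + l (restrictInl N k z - q₀) • Sum.elim e 0

/-- At such a zero `ccMap` is a multiple of `e`. Its torque vanishes and that of `e` does not, so
the multiple is zero. -/
theorem ccMap_eq_zero_of_augmentedMap {m : Fin N → ℝ} {μ : Fin k → ℝ} {q₀ e : Fin N → Plane}
    {l : (Fin N → Plane) →L[ℝ] ℝ} {z : Fin N ⊕ Fin k → Plane}
    (h : augmentedMap (Sum.elim m μ) q₀ l e z = 0) (he : torque m (z ∘ Sum.inl) e ≠ 0) :
    ccMap (Sum.elim m μ) z = 0 := by
  have h1 := torque_ccMap (Sum.elim m μ) z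
  have h2 := eq_neg_of_add_eq_zero_left h
  rw [h2, ← neg_smul, torque_smul, torque_sumElim_zero] at h1
  have h3 := (mul_eq_zero.1 h1).resolve_right he
  rw [h2, ← neg_smul, h3, zero_smul]

theorem hasFDerivAt_augmentedMap (M : Fin N ⊕ Fin k → ℝ) (q₀ : Fin N → Plane)
    (l : (Fin N → Plane) →L[ℝ] ℝ) (e : Fin N → Plane) {z : Fin N ⊕ Fin k → Plane}
    (hz : Function.Injective z) :
    HasFDerivAt (augmentedMap M q₀ l e)
      (fderiv ℝ (ccMap M) z + (l.comp (restrictInl N k)).smulRight (Sum.elim e 0)) z := by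
  refine ((contDiffAt_ccMap M hz (n := 1)).differentiableAt (by norm_num)).hasFDerivAt.add ?_
  exact (l.hasFDerivAt.comp z ((restrictInl N k).hasFDerivAt.sub_const q₀)).smul_const
    (Sum.elim e 0)

/-- The linear part of `blowUp`. -/
def blowUpLinear (N k : ℕ) (θ : ℝ) :
    (Fin N → Plane) × (Fin k → Plane) →L[ℝ] (Fin N ⊕ Fin k → Plane) :=
  ContinuousLinearMap.pi (Sum.elim
    (fun i => θ ^ 3 • (ContinuousLinearMap.proj i).comp (ContinuousLinearMap.fst ℝ _ _))
    (fun j => θ • (ContinuousLinearMap.proj j).comp (ContinuousLinearMap.snd ℝ _ _)))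

/-- The configuration made of a perturbation of size `θ³` of `q₀` and of a cluster of size `θ`
around `x`. -/
def blowUp (q₀ : Fin N → Plane) (x : Plane) (θ : ℝ) (y : (Fin N → Plane) × (Fin k → Plane)) :
    Fin N ⊕ Fin k → Plane :=
  Sum.elim (q₀ + θ ^ 3 • y.1) (fun j => x + θ • y.2 j)

theorem blowUp_eq (q₀ : Fin N → Plane) (x : Plane) (θ : ℝ)
    (y : (Fin N → Plane) × (Fin k → Plane)) :
    blowUp q₀ x θ y = Sum.elim q₀ (fun _ => x) + blowUpLinear N k θ y := by
  funext s
  rcases s with i | j <;> simp [blowUp, blowUpLinear]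

theorem surjective_blowUpLinear {θ : ℝ} (hθ : θ ≠ 0) :
    Function.Surjective (blowUpLinear N k θ) := by
  intro w
  refine ⟨((θ ^ 3)⁻¹ • (w ∘ Sum.inl), θ⁻¹ • (w ∘ Sum.inr)), ?_⟩
  funext s
  rcases s with i | j
  · simp [blowUpLinear, smul_smul, hθ]
  · simp [blowUpLinear, smul_smul, hθ]

/-- The rescaling of the equations that matches `blowUp`. -/
def rescaling (N k : ℕ) (θ : ℝ) :
    (Fin N ⊕ Fin k → Plane) →L[ℝ] (Fin N → Plane) × (Fin k → Plane) :=
  ((θ ^ 3)⁻¹ • restrictInl N k).prod (θ⁻¹ • restrictInr N k)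

theorem injective_rescaling {θ : ℝ} (hθ : θ ≠ 0) : Function.Injective (rescaling N k θ) := by
  refine (injective_iff_map_eq_zero _).2 fun w hw => ?_
  have h1 : (θ ^ 3)⁻¹ • (w ∘ Sum.inl) = 0 := congrArg Prod.fst hw
  have h2 : θ⁻¹ • (w ∘ Sum.inr) = 0 := congrArg Prod.snd hw
  funext s
  rcases s with i | j
  · exact congrFun ((smul_eq_zero.1 h1).resolve_left (inv_ne_zero (pow_ne_zero 3 hθ))) i
  · exact congrFun ((smul_eq_zero.1 h2).resolve_left (inv_ne_zero hθ)) j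

/-- The rescaled equations of central configurations in the blown up variables. -/
def scaledMap (m : Fin N → ℝ) (q₀ : Fin N → Plane) (x : Plane) (μ : Fin k → ℝ)
    (l : (Fin N → Plane) →L[ℝ] ℝ) (e : Fin N → Plane) (θ : ℝ)
    (y : (Fin N → Plane) × (Fin k → Plane)) : (Fin N → Plane) × (Fin k → Plane) :=
  rescaling N k θ
    (augmentedMap (Sum.elim m (fun j => θ ^ 3 * μ j)) q₀ l e (blowUp q₀ x θ y))

/-- The limit of `scaledMap` as `θ → 0⁺`. -/
def limitMap (m : Fin N → ℝ) (q₀ : Fin N → Plane) (x : Plane) (μ : Fin k → ℝ)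
    (l : (Fin N → Plane) →L[ℝ] ℝ) (e : Fin N → Plane)
    (y : (Fin N → Plane) × (Fin k → Plane)) : (Fin N → Plane) × (Fin k → Plane) :=
  ((fderiv ℝ (ccMap m) q₀ + l.smulRight e) y.1 -
    fun i => ∑ j, μ j • newtonKernel (q₀ i - x), inducedGradient m q₀ x μ y.2)

theorem fst_scaledMap (m : Fin N → ℝ) (q₀ : Fin N → Plane) (x : Plane) (μ : Fin k → ℝ)
    (l : (Fin N → Plane) →L[ℝ] ℝ) (e : Fin N → Plane) {θ : ℝ} (hθ : 0 < θ)
    (y : (Fin N → Plane) × (Fin k → Plane)) (i : Fin N) :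
    (scaledMap m q₀ x μ l e θ y).1 i = ((θ ^ 3)⁻¹ • ccMap m (q₀ + θ ^ 3 • y.1)) i + l y.1 • e i -
      ∑ j, μ j • newtonKernel (q₀ i - x + θ • (θ ^ 2 • y.1 i - y.2 j)) := by
  have h3 : θ ^ 3 ≠ 0 := (pow_pos hθ 3).ne'
  have hq : restrictInl N k (blowUp q₀ x θ y) - q₀ = θ ^ 3 • y.1 := by
    rw [restrictInl_apply, blowUp, Sum.elim_comp_inl, add_sub_cancel_left]
  have h1 : (scaledMap m q₀ x μ l e θ y).1 i = (θ ^ 3)⁻¹ •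
      (ccMap (Sum.elim m (fun j => θ ^ 3 * μ j)) (blowUp q₀ x θ y) (Sum.inl i) +
        l (restrictInl N k (blowUp q₀ x θ y) - q₀) • e i) := rfl
  have h2 : ∀ j, (q₀ + θ ^ 3 • y.1) i - (x + θ • y.2 j) =
      q₀ i - x + θ • (θ ^ 2 • y.1 i - y.2 j) := fun j => by
    rw [Pi.add_apply, Pi.smul_apply, smul_sub, smul_smul, ← pow_succ']
    abel
  rw [h1, hq, blowUp, ccMap_sumElim_inl, map_smul, smul_eq_mul, mul_smul, smul_add, smul_sub,
    inv_smul_smul₀ h3, Finset.smul_sum, Pi.smul_apply]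
  simp only [h2, mul_smul, inv_smul_smul₀ h3]
  abel

/-- The kernel is homogeneous of degree `-2` and `θ⁻¹ θ³ θ⁻² = 1`, so the interaction inside the
cluster is free of `θ`. The correction along `e` does not touch the light bodies. -/
theorem snd_scaledMap (m : Fin N → ℝ) (q₀ : Fin N → Plane) (x : Plane) (μ : Fin k → ℝ)
    (l : (Fin N → Plane) →L[ℝ] ℝ) (e : Fin N → Plane) {θ : ℝ} (hθ : 0 < θ)
    (y : (Fin N → Plane) × (Fin k → Plane)) (j : Fin k) :
    (scaledMap m q₀ x μ l e θ y).2 j =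
      θ⁻¹ • restrictedGradient m (q₀ + θ • θ ^ 2 • y.1) (x + θ • y.2 j) -
        ∑ i, μ i • newtonKernel (y.2 j - y.2 i) := by
  have h1 : (scaledMap m q₀ x μ l e θ y).2 j = θ⁻¹ •
      (ccMap (Sum.elim m (fun j => θ ^ 3 * μ j)) (blowUp q₀ x θ y) (Sum.inr j) +
        l (restrictInl N k (blowUp q₀ x θ y) - q₀) • (0 : Fin k → Plane) j) := rfl
  rw [h1, blowUp, ccMap_sumElim_inr, Pi.zero_apply, smul_zero, add_zero, smul_sub,
    Finset.smul_sum, smul_smul θ (θ ^ 2), ← pow_succ']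
  congr 1
  refine Finset.sum_congr rfl fun i _ => ?_
  rw [add_sub_add_left_eq_sub, ← smul_sub, newtonKernel_smul hθ, smul_smul, smul_smul]
  congr 1
  field_simp

variable {m : Fin N → ℝ} {q₀ : Fin N → Plane} {x : Plane}

theorem isSmallFamily_newtonKernel_interaction {a : Plane} (ha : x ≠ a) (i : Fin N) (j : Fin k) :
    IsSmallFamily (fun θ (y : (Fin N → Plane) × (Fin k → Plane)) =>
      newtonKernel (a - x + θ • (θ ^ 2 • y.1 i - y.2 j)) - newtonKernel (a - x)) := by
  let B : ℝ → (Fin N → Plane) × (Fin k → Plane) →L[ℝ] Plane := fun θ =>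
    θ ^ 2 • (ContinuousLinearMap.proj (R := ℝ) (φ := fun _ : Fin N => Plane) i).comp
      (ContinuousLinearMap.fst ℝ _ _) -
    (ContinuousLinearMap.proj (R := ℝ) (φ := fun _ : Fin k => Plane) j).comp
      (ContinuousLinearMap.snd ℝ _ _)
  have hB : Continuous B := by fun_prop
  have h := (isSmallFamily_of_contDiffAt_one
    (contDiffAt_newtonKernel (sub_ne_zero.2 ha.symm))).comp_clm hB
  have hBy : ∀ θ y, B θ y = θ ^ 2 • y.1 i - y.2 j := fun θ y => by simp [B]
  simpa only [hBy] using h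

theorem isSmallFamily_fst_scaledMap (hq : Function.Injective q₀) (h0 : ccMap m q₀ = 0)
    (hx : ∀ i, x ≠ q₀ i) (μ : Fin k → ℝ) (l : (Fin N → Plane) →L[ℝ] ℝ) (e : Fin N → Plane) :
    IsSmallFamily (fun θ y => (scaledMap m q₀ x μ l e θ y).1 - (limitMap m q₀ x μ l e y).1) := by
  have h1 := ((isSmallFamily_inv_smul_sub_fderiv (contDiffAt_ccMap m hq) h0).comp_pow
    three_ne_zero).comp_clm (B := fun _ => ContinuousLinearMap.fst ℝ (Fin N → Plane)
      (Fin k → Plane)) continuous_const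
  refine isSmallFamily_pi fun i => ?_
  have h3 := (h1.clm_comp (ContinuousLinearMap.proj (R := ℝ) (φ := fun _ : Fin N => Plane) i)).add
    (isSmallFamily_sum Finset.univ fun j _ =>
      (isSmallFamily_newtonKernel_interaction (hx i) i j).clm_comp
        (-μ j • ContinuousLinearMap.id ℝ Plane))
  refine h3.congr fun θ hθ => ?_
  funext y
  rw [Pi.sub_apply, fst_scaledMap m q₀ x μ l e hθ]
  have hl : (limitMap m q₀ x μ l e y).1 i = fderiv ℝ (ccMap m) q₀ y.1 i + l y.1 • e i -
      ∑ j, μ j • newtonKernel (q₀ i - x) := rfl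
  rw [hl]
  simp only [ContinuousLinearMap.coe_fst', ContinuousLinearMap.proj_apply, Pi.sub_apply,
    smul_apply, ContinuousLinearMap.id_apply, neg_smul, smul_sub,
    Finset.sum_sub_distrib, Finset.sum_neg_distrib]
  abel

theorem isSmallFamily_snd_scaledMap (hx : ∀ i, x ≠ q₀ i) (hg : restrictedGradient m q₀ x = 0)
    (μ : Fin k → ℝ) (l : (Fin N → Plane) →L[ℝ] ℝ) (e : Fin N → Plane) :
    IsSmallFamily (fun θ y => (scaledMap m q₀ x μ l e θ y).2 - (limitMap m q₀ x μ l e y).2) := by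
  set g : (Fin N → Plane) × Plane → Plane := fun z => restrictedGradient m z.1 z.2 with hgdef
  have hgc : ContDiffAt ℝ 2 g (q₀, x) := contDiffAt_restrictedGradient_uncurry hx
  have hgd : ∀ u, fderiv ℝ (restrictedGradient m q₀) x u = fderiv ℝ g (q₀, x) (0, u) := fun u => by
    have h1 : HasFDerivAt (fun p : Plane => g (q₀, p))
        ((fderiv ℝ g (q₀, x)).comp (ContinuousLinearMap.inr ℝ _ _)) x :=
      (hgc.differentiableAt (by norm_num)).hasFDerivAt.comp x (hasFDerivAt_prodMk_right q₀ x)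
    change fderiv ℝ (fun p : Plane => g (q₀, p)) x u = _
    rw [h1.fderiv]
    simp
  refine isSmallFamily_pi fun j => ?_
  have h1 := (isSmallFamily_inv_smul_sub_fderiv hgc hg).comp_clm
    (B := fun θ : ℝ => θ ^ 2 • (ContinuousLinearMap.inl ℝ (Fin N → Plane) Plane).comp
      (ContinuousLinearMap.fst ℝ (Fin N → Plane) (Fin k → Plane)) +
        (ContinuousLinearMap.inr ℝ (Fin N → Plane) Plane).comp
          ((ContinuousLinearMap.proj j).comp (ContinuousLinearMap.snd ℝ _ _))) (by fun_prop)
  -- The linear effect of the heavy displacement on the cluster is `θ² Dg (v, 0)`; it is absent from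
  -- the limit and belongs to the error.
  have h2 := (isSmallFamily_smul_clm ((fderiv ℝ g (q₀, x)).comp
    ((ContinuousLinearMap.inl ℝ (Fin N → Plane) Plane).comp
      (ContinuousLinearMap.fst ℝ (Fin N → Plane) (Fin k → Plane))))).comp_pow two_ne_zero
  refine (h1.add h2).congr fun θ hθ => ?_
  funext y
  rw [Pi.sub_apply, snd_scaledMap m q₀ x μ l e hθ]
  have hsplit : (θ ^ 2 • y.1, y.2 j) = θ ^ 2 • (y.1, (0 : Plane)) + (0, y.2 j) := by simp
  simp [limitMap, inducedGradient, hgd, hgdef]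
  rw [hsplit, map_add, map_smul]
  abel

theorem isSmallFamily_scaledMap (hq : Function.Injective q₀) (h0 : ccMap m q₀ = 0)
    (hx : ∀ i, x ≠ q₀ i) (hg : restrictedGradient m q₀ x = 0)
    (μ : Fin k → ℝ) (l : (Fin N → Plane) →L[ℝ] ℝ) (e : Fin N → Plane) :
    IsSmallFamily (fun θ y => scaledMap m q₀ x μ l e θ y - limitMap m q₀ x μ l e y) :=
  (isSmallFamily_fst_scaledMap hq h0 hx μ l e).prodMk (isSmallFamily_snd_scaledMap hx hg μ l e)

theorem hasFDerivAt_scaledMap (m : Fin N → ℝ) (q₀ : Fin N → Plane) (x : Plane) (μ : Fin k → ℝ)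
    (l : (Fin N → Plane) →L[ℝ] ℝ) (e : Fin N → Plane) {θ : ℝ}
    {y : (Fin N → Plane) × (Fin k → Plane)} (hy : Function.Injective (blowUp q₀ x θ y)) :
    HasFDerivAt (scaledMap m q₀ x μ l e θ)
      ((rescaling N k θ).comp ((fderiv ℝ (ccMap (Sum.elim m (fun j => θ ^ 3 * μ j)))
        (blowUp q₀ x θ y) + (l.comp (restrictInl N k)).smulRight (Sum.elim e 0)).comp
          (blowUpLinear N k θ))) y := by
  have h1 : HasFDerivAt (blowUp q₀ x θ) (blowUpLinear N k θ) y := by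
    rw [funext (blowUp_eq q₀ x θ)]
    exact (blowUpLinear N k θ).hasFDerivAt.const_add _
  exact (rescaling N k θ).hasFDerivAt.comp y
    ((hasFDerivAt_augmentedMap _ q₀ l e hy).comp y h1)

theorem isNondegenerateNormalizedCC_blowUp (hm : ∀ i, 0 < m i) {μ : Fin k → ℝ}
    (hμ : ∀ j, 0 < μ j) {l : (Fin N → Plane) →L[ℝ] ℝ} {e : Fin N → Plane} {θ : ℝ} (hθ : 0 < θ)
    {y : (Fin N → Plane) × (Fin k → Plane)} (hy : Function.Injective (blowUp q₀ x θ y))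
    (he : torque m (q₀ + θ ^ 3 • y.1) e ≠ 0) (h0 : scaledMap m q₀ x μ l e θ y = 0)
    (hD : ∀ D : (Fin N → Plane) × (Fin k → Plane) →L[ℝ] (Fin N → Plane) × (Fin k → Plane),
      HasFDerivAt (scaledMap m q₀ x μ l e θ) D y → Function.Injective D) :
    IsNondegenerateNormalizedCC (Sum.elim m (fun j => θ ^ 3 * μ j)) (blowUp q₀ x θ y) := by
  have he' : torque m (blowUp q₀ x θ y ∘ Sum.inl) e ≠ 0 := he
  have hcc := ccMap_eq_zero_of_augmentedMap
    (injective_rescaling hθ.ne' (h0.trans (map_zero _).symm)) he'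
  have hM : ∀ s, 0 < Sum.elim m (fun j => θ ^ 3 * μ j) s := by
    rintro (i | j)
    · exact hm i
    · exact mul_pos (pow_pos hθ 3) (hμ j)
  refine ⟨(isNormalizedCC_iff hM).2 ⟨hy, hcc⟩, ?_⟩
  rw [← finrank_config]
  refine finrank_range_add_one_of_injective_add_smulRight
    (notMem_range_fderiv_ccMap hy hcc (e := Sum.elim e 0) (by rwa [torque_sumElim_zero]))
    (l := (l.comp (restrictInl N k)).toLinearMap) ?_
  have hinj := hD _ (hasFDerivAt_scaledMap m q₀ x μ l e hy)
  -- Surjectivity of `blowUpLinear` carries injectivity from the rescaled derivative to the unscaled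
  -- one.
  intro w w' hw
  obtain ⟨u, rfl⟩ := surjective_blowUpLinear hθ.ne' w
  obtain ⟨u', rfl⟩ := surjective_blowUpLinear hθ.ne' w'
  exact congrArg _ (hinj (congrArg (rescaling N k θ) hw))

theorem exists_continuousLinearEquiv_of_injective {V : Type*} [NormedAddCommGroup V]
    [NormedSpace ℝ V] [FiniteDimensional ℝ V] {A : V →L[ℝ] V} (hA : Function.Injective A) :
    ∃ L : V ≃L[ℝ] V, (L : V →L[ℝ] V) = A :=
  ⟨(LinearEquiv.ofInjectiveEndo A.toLinearMap hA).toContinuousLinearEquiv, by ext; rfl⟩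

theorem injective_blowUp {θ : ℝ} (hθ : 0 < θ) {y : (Fin N → Plane) × (Fin k → Plane)}
    (h1 : Function.Injective (q₀ + θ ^ 3 • y.1)) (h2 : Function.Injective y.2)
    (h3 : ∀ i j, (q₀ + θ ^ 3 • y.1) i ≠ x + θ • y.2 j) : Function.Injective (blowUp q₀ x θ y) :=
  h1.sumElim (fun _ _ hij => h2 (smul_right_injective Plane hθ.ne' (add_left_cancel hij))) h3

/-- All these conditions are open and hold at `θ = 0`. Collisions within the cluster are tested on
`w`, since at `θ = 0` the light bodies themselves coincide. -/
theorem eventually_blowUp_regular (hq : Function.Injective q₀) (hx : ∀ i, x ≠ q₀ i)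
    {e : Fin N → Plane} (he : torque m q₀ e ≠ 0) {y₀ : (Fin N → Plane) × (Fin k → Plane)}
    (hy₀ : Function.Injective y₀.2) :
    ∀ᶠ z : ℝ × ((Fin N → Plane) × (Fin k → Plane)) in 𝓝 (0, y₀),
      Function.Injective (q₀ + z.1 ^ 3 • z.2.1) ∧ Function.Injective z.2.2 ∧
      (∀ i j, (q₀ + z.1 ^ 3 • z.2.1) i ≠ x + z.1 • z.2.2 j) ∧
      torque m (q₀ + z.1 ^ 3 • z.2.1) e ≠ 0 := by
  have hQ : Continuous fun z : ℝ × ((Fin N → Plane) × (Fin k → Plane)) =>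
      q₀ + z.1 ^ 3 • z.2.1 := by fun_prop
  have hQ0 : Tendsto (fun z : ℝ × ((Fin N → Plane) × (Fin k → Plane)) =>
      q₀ + z.1 ^ 3 • z.2.1) (𝓝 (0, y₀)) (𝓝 q₀) := by
    simpa using hQ.tendsto (0, y₀)
  refine (hQ0.eventually (eventually_injective hq)).and (Eventually.and ?_ (Eventually.and ?_ ?_))
  · have : Continuous fun z : ℝ × ((Fin N → Plane) × (Fin k → Plane)) => z.2.2 := by fun_prop
    exact (this.tendsto (0, y₀)).eventually (eventually_injective hy₀)
  · refine eventually_all.2 fun i => eventually_all.2 fun j => ?_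
    have hd : Continuous fun z : ℝ × ((Fin N → Plane) × (Fin k → Plane)) =>
        (q₀ + z.1 ^ 3 • z.2.1) i - (x + z.1 • z.2.2 j) :=
      ((continuous_apply i).comp hQ).sub (by fun_prop)
    have hd0 : (q₀ + (0 : ℝ) ^ 3 • y₀.1) i - (x + (0 : ℝ) • y₀.2 j) ≠ 0 := by
      simpa [sub_eq_zero] using (hx i).symm
    filter_upwards [(hd.tendsto (0, y₀)).eventually_ne hd0] with z hz using sub_ne_zero.1 hz
  · have hT : Continuous fun q : Fin N → Plane => torque m q e := by
      unfold torque
      fun_prop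
    exact hQ0.eventually ((hT.tendsto q₀).eventually_ne he)

end BlowUp

end Rescaled

/-! ### Continuation of the limit zero to small `θ > 0`. -/

section Continuation

open Filter Topology

variable {N k : ℕ} {m : Fin N → ℝ} {q₀ : Fin N → Plane} {x : Plane} {μ : Fin k → ℝ}
  {p₀ : Fin k → Plane}

/-- The limit is decoupled: `v₀` solves the linear heavy equation against the pull of the whole
cluster placed at `x`, and the derivative is a product of two injective maps. -/
theorem exists_hasStrictFDerivAt_limitMap (l : (Fin N → Plane) →L[ℝ] ℝ) (e : Fin N → Plane)
    (hA : Function.Injective (fderiv ℝ (ccMap m) q₀ + l.smulRight e))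
    (hp : Function.Injective p₀) (hp0 : inducedGradient m q₀ x μ p₀ = 0)
    (hB : Function.Injective (fderiv ℝ (inducedGradient m q₀ x μ) p₀)) :
    ∃ v₀ : Fin N → Plane, limitMap m q₀ x μ l e (v₀, p₀) = 0 ∧
      ∃ L : ((Fin N → Plane) × (Fin k → Plane)) ≃L[ℝ] ((Fin N → Plane) × (Fin k → Plane)),
        HasStrictFDerivAt (limitMap m q₀ x μ l e)
          (L : _ →L[ℝ] (Fin N → Plane) × (Fin k → Plane)) (v₀, p₀) := by
  obtain ⟨v₀, hv₀⟩ := LinearMap.injective_iff_surjective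
    (f := (fderiv ℝ (ccMap m) q₀ + l.smulRight e).toLinearMap).1 hA
      (fun i => ∑ j, μ j • newtonKernel (q₀ i - x))
  refine ⟨v₀, Prod.ext (sub_eq_zero.2 hv₀) hp0, ?_⟩
  obtain ⟨L, hL⟩ := exists_continuousLinearEquiv_of_injective
    (A := (fderiv ℝ (ccMap m) q₀ + l.smulRight e).prodMap
      (fderiv ℝ (inducedGradient m q₀ x μ) p₀)) (hA.prodMap hB)
  refine ⟨L, ?_⟩
  rw [hL]
  have h1 : HasStrictFDerivAt (inducedGradient m q₀ x μ)
      (fderiv ℝ (inducedGradient m q₀ x μ) p₀) p₀ :=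
    (contDiffAt_inducedGradient hp (n := 1)).hasStrictFDerivAt (by norm_num)
  exact (((fderiv ℝ (ccMap m) q₀ + l.smulRight e).hasStrictFDerivAt.comp (v₀, p₀)
    hasStrictFDerivAt_fst).sub_const _).prodMk
      (HasStrictFDerivAt.comp (v₀, p₀) h1 hasStrictFDerivAt_snd)

theorem eventually_forall_of_norm_sub_le {Y : Type*} [NormedAddCommGroup Y] {y₀ : Y}
    {G : ℝ × Y → Prop} (hG : ∀ᶠ z in 𝓝 ((0 : ℝ), y₀), G z) (C : ℝ) :
    ∀ᶠ θ in 𝓝[>] (0 : ℝ), ∀ y, ‖y - y₀‖ ≤ C * θ → G (θ, y) := by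
  obtain ⟨δ, hδ, h⟩ := Metric.eventually_nhds_iff.1 hG
  have hC : ∀ᶠ θ in 𝓝[>] (0 : ℝ), C * θ < δ := by
    have : Tendsto (fun θ : ℝ => C * θ) (𝓝 0) (𝓝 (C * 0)) :=
      (continuous_const.mul continuous_id).tendsto 0
    rw [mul_zero] at this
    exact (this.mono_left nhdsWithin_le_nhds).eventually_lt_const hδ
  have hθδ : ∀ᶠ θ in 𝓝[>] (0 : ℝ), θ < δ :=
    eventually_nhdsWithin_of_eventually_nhds (eventually_lt_nhds hδ)
  filter_upwards [hC, hθδ, eventually_pos_nhdsGT] with θ h1 h2 h3 y hy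
  refine h ?_
  rw [Prod.dist_eq, max_lt_iff, dist_eq_norm, dist_eq_norm, sub_zero, Real.norm_of_nonneg h3.le]
  exact ⟨h2, hy.trans_lt h1⟩

theorem eventually_exists_isNondegenerateNormalizedCC (hm : ∀ i, 0 < m i)
    (hq : IsNondegenerateNormalizedCC m q₀) (hx : IsRestrictedRelEquilibrium m q₀ x)
    (hμ : ∀ j, 0 < μ j) (hp : IsNondegenerateInducedCC m q₀ x μ p₀) :
    ∃ C : ℝ, ∀ᶠ θ in 𝓝[>] (0 : ℝ), ∃ (q : Fin N → Plane) (p : Fin k → Plane),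
      IsNondegenerateNormalizedCC (Sum.elim m (fun j => θ ^ 3 * μ j)) (Sum.elim q p) ∧
      (∀ i, ‖q i - q₀ i‖ ≤ C * θ ^ 3) ∧ (∀ j, ‖p j - (x + θ • p₀ j)‖ ≤ C * θ ^ 2) := by
  obtain ⟨hqinj, hq0⟩ := (isNormalizedCC_iff hm).1 hq.1
  set e : Fin N → Plane := rotationField q₀
  -- The torque of the rotation field is the moment of inertia `∑ mᵢ |qᵢ|²`.
  have he : torque m q₀ e ≠ 0 := (torque_rotationField_pos hm hq.ne_zero).ne'
  obtain ⟨l', hl'⟩ := exists_injective_add_smulRight (e := e)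
    (hq.2.trans finrank_config.symm) (notMem_range_fderiv_ccMap hqinj hq0 he)
  set l : (Fin N → Plane) →L[ℝ] ℝ := LinearMap.toContinuousLinearMap l'
  obtain ⟨v₀, hv₀, L, hL⟩ := exists_hasStrictFDerivAt_limitMap l e (m := m) (q₀ := q₀) (x := x)
    (μ := μ) hl' hp.1.1 (hp.1.inducedGradient_eq_zero hμ hx.1)
    (hp.injective_fderiv_inducedGradient hx.1)
  obtain ⟨C, hC⟩ := exists_zero_of_isSmallFamily hL hv₀
    (isSmallFamily_scaledMap hqinj hq0 hx.1 hx.restrictedGradient_eq_zero μ l e)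
  -- Limit plus error collapses to `scaledMap` itself.
  simp only [add_sub_cancel] at hC
  -- For `θ < 1` this bounds `‖v‖`, giving the `θ³` estimate; for the cluster, `w - p₀ = O(θ)` is
  -- multiplied by `θ`.
  refine ⟨‖v₀‖ + |C|, ?_⟩
  have h1 : ∀ᶠ θ in 𝓝[>] (0 : ℝ), θ < 1 :=
    eventually_nhdsWithin_of_eventually_nhds (eventually_lt_nhds one_pos)
  filter_upwards [hC, h1, eventually_pos_nhdsGT, eventually_forall_of_norm_sub_le
    (eventually_blowUp_regular (y₀ := (v₀, p₀)) hqinj hx.1 he hp.1.1) C] with θ hθ hθ1 hθ0 hreg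
  obtain ⟨y, hy, hy0, hD⟩ := hθ
  obtain ⟨r1, r2, r3, r4⟩ := hreg y hy
  have hCθ : C * θ ≤ |C| * θ := by gcongr; exact le_abs_self C
  refine ⟨q₀ + θ ^ 3 • y.1, fun j => x + θ • y.2 j,
    isNondegenerateNormalizedCC_blowUp hm hμ hθ0 (injective_blowUp hθ0 r1 r2 r3) r4 hy0 hD,
    fun i => ?_, fun j => ?_⟩
  · have h2 : ‖y.1‖ ≤ ‖v₀‖ + |C| := by
      have h3 : ‖y.1 - v₀‖ ≤ |C| * θ := ((norm_fst_le (y - (v₀, p₀))).trans hy).trans hCθ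
      have h4 : |C| * θ ≤ |C| := mul_le_of_le_one_right (abs_nonneg C) hθ1.le
      have h5 := norm_add_le v₀ (y.1 - v₀)
      rw [add_sub_cancel] at h5
      linarith
    rw [Pi.add_apply, add_sub_cancel_left, Pi.smul_apply, norm_smul,
      Real.norm_of_nonneg (pow_pos hθ0 3).le, mul_comm]
    gcongr
    exact (norm_le_pi_norm y.1 i).trans h2
  · have h3 : ‖y.2 j - p₀ j‖ ≤ |C| * θ :=
      (norm_le_pi_norm (y.2 - p₀) j).trans
        (((norm_snd_le (y - (v₀, p₀))).trans hy).trans hCθ)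
    rw [add_sub_add_left_eq_sub, ← smul_sub, norm_smul, Real.norm_of_nonneg hθ0.le]
    calc θ * ‖y.2 j - p₀ j‖ ≤ θ * (|C| * θ) := by gcongr
      _ = |C| * θ ^ 2 := by ring
      _ ≤ (‖v₀‖ + |C|) * θ ^ 2 := by gcongr; linarith [norm_nonneg v₀]

end Continuation

end CentralConfig

end

theorem mainTheorem1 {N k : ℕ}
    (m : Fin N → ℝ) (hm : ∀ i, 0 < m i)
    (qhat : Fin N → CentralConfig.Plane)
    (hq : CentralConfig.IsNondegenerateNormalizedCC m qhat)
    (xstar : CentralConfig.Plane)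
    (hx : CentralConfig.IsNondegenerateRestrictedRelEquilibrium m qhat xstar)
    (μ : Fin k → ℝ) (hμ : ∀ j, 0 < μ j) (hμsum : ∑ j, μ j = 1)
    (phat : Fin k → CentralConfig.Plane)
    (hp : CentralConfig.IsNondegenerateInducedCC m qhat xstar μ phat) :
    ∃ Θ₀ > (0 : ℝ), ∃ C : ℝ, ∀ Θ : ℝ, 0 < Θ → Θ < Θ₀ →
      ∃ (q : Fin N → CentralConfig.Plane) (p : Fin k → CentralConfig.Plane),
        CentralConfig.IsNondegenerateNormalizedCC
          (Sum.elim m (fun j => Θ * μ j)) (Sum.elim q p) ∧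
        (∀ i, ‖q i - qhat i‖ ≤ C * Θ) ∧
        (∀ j, ‖p j - (xstar + Θ ^ (1 / 3 : ℝ) • phat j)‖ ≤ C * Θ ^ (2 / 3 : ℝ)) := by
  obtain ⟨C, hC⟩ :=
    CentralConfig.eventually_exists_isNondegenerateNormalizedCC hm hq hx.1 hμ hp
  obtain ⟨δ, hδ, h⟩ := (nhdsGT_basis (0 : ℝ)).eventually_iff.1 hC
  refine ⟨δ ^ 3, pow_pos hδ 3, C, fun Θ hΘ hΘδ => ?_⟩
  have h3 : (Θ ^ (1 / 3 : ℝ)) ^ 3 = Θ := by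
    rw [← Real.rpow_natCast, ← Real.rpow_mul hΘ.le]
    norm_num
  have h2 : (Θ ^ (1 / 3 : ℝ)) ^ 2 = Θ ^ (2 / 3 : ℝ) := by
    rw [← Real.rpow_natCast, ← Real.rpow_mul hΘ.le]
    norm_num
  have hlt : Θ ^ (1 / 3 : ℝ) < δ := by
    refine lt_of_pow_lt_pow_left₀ 3 hδ.le ?_
    rwa [h3]
  have := h ⟨Real.rpow_pos_of_pos hΘ _, hlt⟩
  rwa [h3, h2] at this
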